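/- Let $n\ge 1$ and let $Y(\mathfrak{gl}_n)$ be the Yangian: the complex unital associative algebra with generators $T_{ij}^{(r)}$ ($1\le i,j\le n$, $r\ge 1$) and relations $(u-v)\,[T_{ij}(u),T_{kl}(v)]=T_{kj}(u)T_{il}(v)-T_{kj}(v)T_{il}(u)$, where $T_{ij}(u)=\delta_{ij}+\sum_{r\ge1}T_{ij}^{(r)}u^{-r}$. Its comultiplication is $T_{ij}(u)\mapsto\sum_{k=1}^n T_{ik}(u)\otimes T_{kj}(u)$, its counit is $T_{ij}(u)\mapsto\delta_{ij}$. For $z\in\mathbb{C}$ the vector module and the covector module are the space $\mathbb{C}^n$ with standard basis $e_1,\dots,e_n$ and the respective actions $$T_{ij}(u)\,e_k=\delta_{ij}e_k+\frac{\delta_{jk}\,e_i}{u-z}\qquad\text{and}\qquad T_{ij}(u)\,e_k=\delta_{ij}e_k-\frac{\delta_{ik}\,e_j}{u-z+1}.$$ A $Y(\mathfrak{gl}_n)$-module is called polynomial if it is isomorphic to a subquotient of a tensor product of finitely many vector modules, and rational if it is isomorphic to a subquotient of a tensor product of finitely many vector and covector modules (in any order); the empty tensor product is the trivial module $\mathbb{C}$,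 given by the counit. Let $A_n(u)\in\mathbb{C}[[u^{-1}]]$ have leading term $1$, and let $P_1(u),\dots,P_{n-1}(u)$ be monic polynomials with complex coefficients. Let $\Psi$ be the irreducible finite-dimensional $Y(\mathfrak{gl}_n)$-module determined by $A_n(u)$ and $P_1(u),\dots,P_{n-1}(u)$; that is, $\Psi$ contains a vector $v\ne0$ such that $T_{ij}(u)\,v=0$ for all $i<j$ and $T_{ii}(u)\,v=A_i(u)\,v$ for $i=1,\dots,n$, where the series $A_1(u),\dots,A_{n-1}(u)\in\mathbb{C}[[u^{-1}]]$ satisfy $$\frac{A_i(u)}{A_{i+1}(u)}=\frac{P_i(u+1)}{P_i(u)}\qquad\text{for } i=1,\dots,n-1,$$ rational functions of $u$ being expanded in $u^{-1}$. Then: (1) $\Psi$ is polynomial if and only if there is a non-zero polynomial $Q_n(u)\in\mathbb{C}[u]$ such that $$A_n(u)=\frac{Q_n(u+1)}{Q_n(u)};$$ (2) $\Psi$ is rational if and only if there is a non-zero rational function $Q_n(u)\in\mathbb{C}(u)$ satisfying the same equality. -/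

import Mathlib

open scoped TensorProduct

/-- The relations satisfied by the coefficients `t i j r` of `u⁻ʳ` in series `T_{ij}(u)` with
leading terms `δ_{ij}` such that
`(u - v) [T_{ij}(u), T_{kl}(v)] = T_{kj}(u) T_{il}(v) - T_{kj}(v) T_{il}(u)`:
the relation `rel` compares the coefficients of `u⁻ʳ v⁻ˢ` on both sides. -/
structure IsYangianFamily {n : ℕ} {A : Type*} [Ring A] (t : Fin n → Fin n → ℕ → A) : Prop where
  zero : ∀ i j, t i j 0 = if i = j then 1 else 0
  rel : ∀ i j k l r s,
    (t i j (r + 1) * t k l s - t k l s * t i j (r + 1))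
      - (t i j r * t k l (s + 1) - t k l (s + 1) * t i j r)
      = t k j r * t i l s - t k j s * t i l r

namespace Yangian

/-- In the free algebra on `T_{ij}^{(1)}, T_{ij}^{(2)}, …`, the coefficient of `u⁻ʳ` in `T_{ij}(u)`;
the generator `(i, j, r)` is `T_{ij}^{(r+1)}`. -/
def freeT (n : ℕ) (i j : Fin n) : ℕ → FreeAlgebra ℂ (Fin n × Fin n × ℕ)
  | 0 => if i = j then 1 else 0
  | r + 1 => FreeAlgebra.ι ℂ (i, j, r)

/-- The defining relations of the Yangian of `gl_n`. -/
inductive Rel (n : ℕ) :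
    FreeAlgebra ℂ (Fin n × Fin n × ℕ) → FreeAlgebra ℂ (Fin n × Fin n × ℕ) → Prop
  | mk (i j k l : Fin n) (r s : ℕ) : Rel n
      ((freeT n i j (r + 1) * freeT n k l s - freeT n k l s * freeT n i j (r + 1))
        - (freeT n i j r * freeT n k l (s + 1) - freeT n k l (s + 1) * freeT n i j r))
      (freeT n k j r * freeT n i l s - freeT n k j s * freeT n i l r)

end Yangian

/-- The Yangian `Y(gl_n)`, a complex unital associative algebra. -/
def Yangian (n : ℕ) : Type := RingQuot (Yangian.Rel n)

namespace Yangian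

noncomputable section

instance (n : ℕ) : Ring (Yangian n) := inferInstanceAs (Ring (RingQuot (Rel n)))

instance (n : ℕ) : Algebra ℂ (Yangian n) := inferInstanceAs (Algebra ℂ (RingQuot (Rel n)))

/-- The quotient map from the free algebra. -/
def mk (n : ℕ) : FreeAlgebra ℂ (Fin n × Fin n × ℕ) →ₐ[ℂ] Yangian n :=
  RingQuot.mkAlgHom ℂ (Rel n)

/-- `T i j r` is the coefficient `T_{ij}^{(r)}` of `u⁻ʳ` in `T_{ij}(u)`, with
`T_{ij}^{(0)} = δ_{ij}`. -/
def T {n : ℕ} (i j : Fin n) (r : ℕ) : Yangian n := mk n (freeT n i j r)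

theorem isYangianFamily_T (n : ℕ) : IsYangianFamily (T (n := n)) where
  zero i j := by
    simp only [T, freeT]
    split <;> simp
  rel i j k l r s := by
    have h := RingQuot.mkAlgHom_rel ℂ (Rel.mk i j k l r s)
    change mk n _ = mk n _ at h
    simpa only [T, map_sub, map_mul] using h

/-- The universal property of the Yangian. -/
def lift {n : ℕ} {A : Type*} [Ring A] [Algebra ℂ A] (t : Fin n → Fin n → ℕ → A)
    (ht : IsYangianFamily t) : Yangian n →ₐ[ℂ] A :=
  RingQuot.liftAlgHom ℂ ⟨FreeAlgebra.lift ℂ fun x => t x.1 x.2.1 (x.2.2 + 1), by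
    have key : ∀ i j r, FreeAlgebra.lift ℂ
        (fun x : Fin n × Fin n × ℕ => t x.1 x.2.1 (x.2.2 + 1)) (freeT n i j r) = t i j r := by
      intro i j r
      cases r with
      | zero => rw [ht.zero]; simp only [freeT]; split <;> simp
      | succ r => simp [freeT]
    rintro _ _ ⟨i, j, k, l, r, s⟩
    simp only [map_sub, map_mul, key]
    exact ht.rel i j k l r s⟩

theorem lift_T {n : ℕ} {A : Type*} [Ring A] [Algebra ℂ A] (t : Fin n → Fin n → ℕ → A)
    (ht : IsYangianFamily t) (i j : Fin n) (r : ℕ) : lift t ht (T i j r) = t i j r := by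
  have h : lift t ht (T i j r) = FreeAlgebra.lift ℂ
        (fun x : Fin n × Fin n × ℕ => t x.1 x.2.1 (x.2.2 + 1)) (freeT n i j r) :=
    RingQuot.liftAlgHom_mkAlgHom_apply ℂ _ _ _
  rw [h]
  cases r with
  | zero => rw [ht.zero]; simp only [freeT]; split <;> simp
  | succ r => simp [freeT]

/-- The coefficients of `∑ₖ a_{ik}(u) b_{kj}(u)`. -/
def conv {n : ℕ} {A : Type*} [Ring A] (a b : Fin n → Fin n → ℕ → A) (i j : Fin n) (r : ℕ) : A :=
  ∑ k, ∑ p ∈ Finset.HasAntidiagonal.antidiagonal r, a i k p.1 * b k j p.2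

theorem conv_def {n : ℕ} {A : Type*} [Ring A] (a b : Fin n → Fin n → ℕ → A) :
    conv a b = fun i j r =>
      ∑ k, ∑ p ∈ Finset.HasAntidiagonal.antidiagonal r, a i k p.1 * b k j p.2 := rfl

/-- The series with coefficients `f`, in the first of two commuting variables. -/
def ser₁ {A : Type*} [Ring A] (f : ℕ → A) : PowerSeries (PowerSeries A) :=
  PowerSeries.C (PowerSeries.mk f)

/-- The series with coefficients `f`, in the second of two commuting variables. -/
def ser₂ {A : Type*} [Ring A] (f : ℕ → A) : PowerSeries (PowerSeries A) :=
  PowerSeries.map PowerSeries.C (PowerSeries.mk f)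

theorem coeff_ser₁_mul_ser₂ {A : Type*} [Ring A] (f g : ℕ → A) (r s : ℕ) :
    PowerSeries.coeff r (PowerSeries.coeff s (ser₁ f * ser₂ g)) = f r * g s := by
  simp [ser₁, ser₂]

theorem coeff_ser₂_mul_ser₁ {A : Type*} [Ring A] (f g : ℕ → A) (r s : ℕ) :
    PowerSeries.coeff r (PowerSeries.coeff s (ser₂ g * ser₁ f)) = g s * f r := by
  simp [ser₁, ser₂]

/-- The relations in terms of the generating series in `x = u⁻¹` and `y = v⁻¹`. -/
theorem rel_iff_series {n : ℕ} {A : Type*} [Ring A] (t : Fin n → Fin n → ℕ → A)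
    (h0 : ∀ i j, t i j 0 = if i = j then 1 else 0) :
    IsYangianFamily t ↔ ∀ i j k l,
      PowerSeries.X * (ser₁ (t i j) * ser₂ (t k l) - ser₂ (t k l) * ser₁ (t i j))
        - PowerSeries.C PowerSeries.X *
          (ser₁ (t i j) * ser₂ (t k l) - ser₂ (t k l) * ser₁ (t i j))
      = PowerSeries.X * (PowerSeries.C PowerSeries.X *
          (ser₁ (t k j) * ser₂ (t i l) - ser₂ (t k j) * ser₁ (t i l))) := by
  have hl0 : ∀ i j (a : A), t i j 0 * a - a * t i j 0 = 0 := by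
    intro i j a; rw [h0]; split <;> simp
  have hr0 : ∀ i j (a : A), a * t i j 0 - t i j 0 * a = 0 := by
    intro i j a; rw [h0]; split <;> simp
  constructor
  · intro ht i j k l
    ext s r
    cases s with
    | zero =>
      cases r with
      | zero => simp
      | succ r =>
        simp only [map_sub, PowerSeries.coeff_zero_X_mul, PowerSeries.coeff_C_mul,
          PowerSeries.coeff_succ_X_mul, coeff_ser₁_mul_ser₂, coeff_ser₂_mul_ser₁, map_zero, hr0,
          sub_zero]
    | succ s =>
      cases r with
      | zero =>
        simp only [map_sub, PowerSeries.coeff_zero_X_mul, PowerSeries.coeff_C_mul,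
          PowerSeries.coeff_succ_X_mul, coeff_ser₁_mul_ser₂, coeff_ser₂_mul_ser₁, hl0, sub_zero]
      | succ r =>
        simp only [map_sub, PowerSeries.coeff_C_mul,
          PowerSeries.coeff_succ_X_mul, coeff_ser₁_mul_ser₂, coeff_ser₂_mul_ser₁]
        exact ht.rel i j k l r s
  · intro h
    refine ⟨h0, fun i j k l r s => ?_⟩
    have := congrArg (fun F => PowerSeries.coeff (r + 1) (PowerSeries.coeff (s + 1) F)) (h i j k l)
    simpa only [map_sub, PowerSeries.coeff_C_mul,
          PowerSeries.coeff_succ_X_mul, coeff_ser₁_mul_ser₂, coeff_ser₂_mul_ser₁] using this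

theorem ser₁_conv {n : ℕ} {A : Type*} [Ring A] (a b : Fin n → Fin n → ℕ → A) (i j : Fin n) :
    ser₁ (conv a b i j) = ∑ k, ser₁ (a i k) * ser₁ (b k j) := by
  simp only [ser₁, ← map_mul, ← map_sum]
  congr 1
  ext r
  simp [conv, PowerSeries.coeff_mul]

theorem ser₂_conv {n : ℕ} {A : Type*} [Ring A] (a b : Fin n → Fin n → ℕ → A) (i j : Fin n) :
    ser₂ (conv a b i j) = ∑ k, ser₂ (a i k) * ser₂ (b k j) := by
  simp only [ser₂, ← map_mul, ← map_sum]
  congr 1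
  ext r
  simp [conv, PowerSeries.coeff_mul]

theorem commute_ser {A : Type*} [Ring A] (f g : ℕ → A) (h : ∀ r s, Commute (f r) (g s)) :
    Commute (ser₁ f) (ser₂ g) ∧ Commute (ser₂ f) (ser₁ g) := by
  constructor
  · ext s r
    rw [coeff_ser₁_mul_ser₂, coeff_ser₂_mul_ser₁]
    exact h _ _
  · ext s r
    rw [coeff_ser₁_mul_ser₂, coeff_ser₂_mul_ser₁]
    exact h _ _

/-- The `RTT` relation for a product of two commuting solutions. -/
theorem rtt_mul {n : ℕ} {R : Type*} [Ring R] (x y : R) (hx : ∀ z, Commute x z)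
    (hy : ∀ z, Commute y z) (a a' b b' : Fin n → Fin n → R)
    (ha : ∀ i j k l, y * (a i j * a' k l - a' k l * a i j) - x * (a i j * a' k l - a' k l * a i j)
      = y * (x * (a k j * a' i l - a' k j * a i l)))
    (hb : ∀ i j k l, y * (b i j * b' k l - b' k l * b i j) - x * (b i j * b' k l - b' k l * b i j)
      = y * (x * (b k j * b' i l - b' k j * b i l)))
    (hab' : ∀ i j k l, Commute (a i j) (b' k l)) (ha'b : ∀ i j k l, Commute (a' i j) (b k l))
    (i j k l : Fin n) :
    let c := fun i j => ∑ m, a i m * b m j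
    let c' := fun i j => ∑ m, a' i m * b' m j
    y * (c i j * c' k l - c' k l * c i j) - x * (c i j * c' k l - c' k l * c i j)
      = y * (x * (c k j * c' i l - c' k j * c i l)) := by
  intro c c'
  have e1 : ∀ i j k l, c i j * c' k l = ∑ p, ∑ q, a i p * a' k q * (b p j * b' q l) := by
    intro i j k l
    simp only [c, c', Finset.sum_mul_sum]
    refine Finset.sum_congr rfl fun p _ => Finset.sum_congr rfl fun q _ => ?_
    rw [mul_assoc, ← mul_assoc (b p j), ← (ha'b k q p j).eq]
    noncomm_ring
  have e2 : ∀ i j k l, c' k l * c i j = ∑ p, ∑ q, a' k q * a i p * (b' q l * b p j) := by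
    intro i j k l
    simp only [c, c', Finset.sum_mul_sum]
    rw [Finset.sum_comm]
    refine Finset.sum_congr rfl fun p _ => Finset.sum_congr rfl fun q _ => ?_
    rw [mul_assoc, ← mul_assoc (b' q l), ← (hab' i p q l).eq]
    noncomm_ring
  have hd : ∀ z, (y - x) * z = z * (y - x) := fun z => by
    rw [sub_mul, mul_sub, (hx z).eq, (hy z).eq]
  have hyx : ∀ z, (y * x) * z = z * (y * x) := fun z => by
    rw [mul_assoc, (hx z).eq, ← mul_assoc, (hy z).eq, mul_assoc]
  have ha2 : ∀ i j k l, (y - x) * (a i j * a' k l - a' k l * a i j) =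
      (y * x) * (a k j * a' i l - a' k j * a i l) := fun i j k l => by
    rw [sub_mul, ha, mul_assoc]
  have hb2 : ∀ i j k l, (y - x) * (b i j * b' k l - b' k l * b i j) =
      (y * x) * (b k j * b' i l - b' k j * b i l) := fun i j k l => by
    rw [sub_mul, hb, mul_assoc]
  rw [← sub_mul, ← mul_assoc]
  have lhs : (y - x) * (c i j * c' k l - c' k l * c i j) = (y * x) *
      ((∑ p, ∑ q, (a k p * a' i q - a' k p * a i q) * (b p j * b' q l)) +
        ∑ p, ∑ q, a' k q * a i p * (b q j * b' p l - b' q j * b p l)) := by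
    rw [e1, e2, ← Finset.sum_sub_distrib, ← Finset.sum_add_distrib, Finset.mul_sum, Finset.mul_sum]
    refine Finset.sum_congr rfl fun p _ => ?_
    rw [← Finset.sum_sub_distrib, ← Finset.sum_add_distrib, Finset.mul_sum, Finset.mul_sum]
    refine Finset.sum_congr rfl fun q _ => ?_
    have : a i p * a' k q * (b p j * b' q l) - a' k q * a i p * (b' q l * b p j) =
        (a i p * a' k q - a' k q * a i p) * (b p j * b' q l) +
        a' k q * a i p * (b p j * b' q l - b' q l * b p j) := by noncomm_ring
    rw [this, mul_add, mul_add, ← mul_assoc, ha2, mul_assoc (y * x)]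
    congr 1
    rw [← mul_assoc, hd, mul_assoc, hb2, ← mul_assoc, ← hyx, mul_assoc]
  rw [lhs, e1, e2]
  congr 1
  have s1 : (∑ p, ∑ q, a' k p * a i q * (b p j * b' q l)) =
      ∑ p, ∑ q, a' k q * a i p * (b q j * b' p l) := Finset.sum_comm
  simp only [sub_mul, mul_sub, Finset.sum_sub_distrib, s1]
  abel

/-- The entries of the product of two commuting `T`-matrices satisfy the Yangian relations. -/
theorem isYangianFamily_conv {n : ℕ} {A : Type*} [Ring A] (a b : Fin n → Fin n → ℕ → A)
    (ha : IsYangianFamily a) (hb : IsYangianFamily b)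
    (hab : ∀ i j r k l s, Commute (a i j r) (b k l s)) : IsYangianFamily (conv a b) := by
  have h0 : ∀ i j, conv a b i j 0 = if i = j then 1 else 0 := by
    intro i j
    simp [conv, ha.zero, hb.zero]
  have hc := fun i j k l => commute_ser (a i j) (b k l) fun r s => hab i j r k l s
  rw [rel_iff_series _ h0]
  intro i j k l
  simp only [ser₁_conv, ser₂_conv]
  refine rtt_mul (n := n) (PowerSeries.C PowerSeries.X) PowerSeries.X (fun z => ?_) (fun z => ?_)
    (fun i j => ser₁ (a i j)) (fun i j => ser₂ (a i j)) (fun i j => ser₁ (b i j))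
    (fun i j => ser₂ (b i j)) ((rel_iff_series a ha.zero).1 ha) ((rel_iff_series b hb.zero).1 hb)
    (fun i j k l => (hc i j k l).1) (fun i j k l => (hc i j k l).2)
    i j k l
  · ext s : 1
    rw [PowerSeries.coeff_C_mul, PowerSeries.coeff_mul_C]
    exact (PowerSeries.commute_X _).eq.symm
  · exact (PowerSeries.commute_X z).symm

theorem IsYangianFamily.map {n : ℕ} {A B : Type*} [Ring A] [Ring B]
    {t : Fin n → Fin n → ℕ → A} (ht : IsYangianFamily t) (f : A →+* B) :
    IsYangianFamily fun i j r => f (t i j r) where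
  zero i j := by rw [ht.zero]; split <;> simp
  rel i j k l r s := by simpa only [map_sub, map_mul] using congrArg f (ht.rel i j k l r s)

/-- The comultiplication `T_{ij}(u) ↦ ∑ₖ T_{ik}(u) ⊗ T_{kj}(u)`. -/
def comul (n : ℕ) : Yangian n →ₐ[ℂ] Yangian n ⊗[ℂ] Yangian n :=
  lift (fun i j r => ∑ k, ∑ p ∈ Finset.HasAntidiagonal.antidiagonal r, T i k p.1 ⊗ₜ[ℂ] T k j p.2) <| by
    have h := isYangianFamily_conv
      (fun i j r => (Algebra.TensorProduct.includeLeft :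
        Yangian n →ₐ[ℂ] Yangian n ⊗[ℂ] Yangian n).toRingHom (T i j r))
      (fun i j r => (Algebra.TensorProduct.includeRight :
        Yangian n →ₐ[ℂ] Yangian n ⊗[ℂ] Yangian n).toRingHom (T i j r))
      (IsYangianFamily.map (isYangianFamily_T n) _) (IsYangianFamily.map (isYangianFamily_T n) _)
      (by intros; simp [Commute, SemiconjBy])
    simp only [AlgHom.toRingHom_eq_coe, RingHom.coe_coe, conv_def,
      Algebra.TensorProduct.includeLeft_apply, Algebra.TensorProduct.includeRight_apply,
      Algebra.TensorProduct.tmul_mul_tmul, one_mul, mul_one] at h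
    exact h

/-- The counit `T_{ij}(u) ↦ δ_{ij}`. -/
def counit (n : ℕ) : Yangian n →ₐ[ℂ] ℂ :=
  lift (fun i j r => if r = 0 then (if i = j then 1 else 0) else 0)
    ⟨fun i j => by simp, fun i j k l r s => by
      rcases r with _ | r <;> rcases s with _ | s <;> simp⟩

end

end Yangian

/-- A complex vector space with an action of `Y(gl_n)`. -/
structure YangianRep (n : ℕ) where
  V : Type
  [addCommGroup : AddCommGroup V]
  [module : Module ℂ V]
  ρ : Yangian n →ₐ[ℂ] Module.End ℂ V

namespace YangianRep

noncomputable section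

attribute [instance] YangianRep.addCommGroup YangianRep.module

instance {n : ℕ} (M : YangianRep n) : Module (Yangian n) M.V :=
  Module.compHom M.V M.ρ.toRingHom

/-- The trivial module, on which `Y(gl_n)` acts through the counit. -/
def triv (n : ℕ) : YangianRep n where
  V := ℂ
  ρ := (Algebra.ofId ℂ (Module.End ℂ ℂ)).comp (Yangian.counit n)

/-- The tensor product of two modules, formed with the comultiplication. -/
def tensor {n : ℕ} (M N : YangianRep n) : YangianRep n where
  V := M.V ⊗[ℂ] N.V
  ρ := (Module.endTensorEndAlgHom (R := ℂ) (A := ℂ) (M := M.V) (N := N.V)).comp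
    ((Algebra.TensorProduct.map M.ρ N.ρ).comp (Yangian.comul n))

/-- The tensor product of a finite sequence of modules; the empty tensor product is trivial. -/
def tensorList {n : ℕ} : List (YangianRep n) → YangianRep n
  | [] => triv n
  | M :: L => tensor M (tensorList L)

/-- The coefficients of the series `δ_{ij} + B_{ij} (u - z)⁻¹ = δ_{ij} + ∑ᵣ zʳ B_{ij} u⁻ʳ⁻¹`. -/
def evalFamily {n : ℕ} {A : Type*} [Ring A] [Algebra ℂ A] (z : ℂ) (B : Fin n → Fin n → A)
    (i j : Fin n) : ℕ → A
  | 0 => if i = j then 1 else 0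
  | r + 1 => z ^ r • B i j

theorem isYangianFamily_evalFamily {n : ℕ} {A : Type*} [Ring A] [Algebra ℂ A] (z : ℂ)
    (B : Fin n → Fin n → A)
    (hB : ∀ i j k l, B i j * B k l - B k l * B i j
      = (if k = j then B i l else 0) - if i = l then B k j else 0) :
    IsYangianFamily (evalFamily z B) where
  zero i j := rfl
  rel i j k l r s := by
    rcases r with _ | r <;> rcases s with _ | s
    · simp only [evalFamily]
      split_ifs <;> simp
    · simp only [evalFamily, pow_zero, one_smul, mul_smul_comm, smul_mul_assoc, ite_mul, mul_ite,
        one_mul, mul_one, zero_mul, mul_zero, ← smul_sub, hB]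
      simp only [smul_sub, smul_ite, smul_zero, sub_self, sub_zero]
    · simp only [evalFamily, pow_zero, one_smul, mul_smul_comm, smul_mul_assoc, ite_mul, mul_ite,
        one_mul, mul_one, zero_mul, mul_zero, ← smul_sub, hB]
      simp only [smul_sub, smul_ite, smul_zero, sub_self, zero_sub, neg_sub]
    · simp only [evalFamily, smul_mul_smul_comm, ← pow_add]
      rw [add_right_comm r 1 s, add_right_comm s 1 r, add_comm s r, ← add_assoc, ← add_assoc,
        add_comm s r, sub_self, sub_self]

/-- The matrix unit `E_{ij}` acting on `ℂⁿ`, so that `E_{ij} e_k = δ_{jk} e_i`. -/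
def E {n : ℕ} (i j : Fin n) : Module.End ℂ (Fin n → ℂ) := Matrix.toLin' (Matrix.single i j 1)

theorem E_mul {n : ℕ} (i j k l : Fin n) :
    (E i j * E k l : Module.End ℂ (Fin n → ℂ)) = if k = j then E i l else 0 := by
  rw [E, E, Module.End.mul_eq_comp, ← Matrix.toLin'_mul]
  split_ifs with h
  · subst h
    simp [E]
  · rw [Matrix.single_mul_single_of_ne _ _ _ _ (Ne.symm h)]
    simp

theorem isYangianFamily_vector (n : ℕ) (z : ℂ) :
    IsYangianFamily (evalFamily z fun i j : Fin n => E i j) :=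
  isYangianFamily_evalFamily _ _ fun i j k l => by simp only [E_mul]

theorem isYangianFamily_covector (n : ℕ) (z : ℂ) :
    IsYangianFamily (evalFamily (z - 1) fun i j : Fin n => -E j i) :=
  isYangianFamily_evalFamily _ _ fun i j k l => by
    have key : ∀ a b : Module.End ℂ (Fin n → ℂ), -a * -b = a * b := fun a b => neg_mul_neg a b
    rw [key, key, E_mul, E_mul]
    by_cases h : i = l <;> by_cases h' : k = j <;>
      simp [h, h', eq_comm (a := l), eq_comm (a := j)]
    abel

/-- The vector module: `T_{ij}(u) e_k = δ_{ij} e_k + δ_{jk} e_i (u - z)⁻¹` on `ℂⁿ`. -/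
def vector (n : ℕ) (z : ℂ) : YangianRep n where
  V := Fin n → ℂ
  ρ := Yangian.lift (evalFamily z fun i j => E i j) (isYangianFamily_vector n z)

/-- The covector module: `T_{ij}(u) e_k = δ_{ij} e_k - δ_{ik} e_j (u - z + 1)⁻¹` on `ℂⁿ`. -/
def covector (n : ℕ) (z : ℂ) : YangianRep n where
  V := Fin n → ℂ
  ρ := Yangian.lift (evalFamily (z - 1) fun i j => -E j i) (isYangianFamily_covector n z)

end

end YangianRep

/-- `V` is isomorphic to a quotient of a submodule of `W`. -/
def IsSubquotient (R V W : Type*) [Ring R] [AddCommGroup V] [Module R V]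
    [AddCommGroup W] [Module R W] : Prop :=
  ∃ (N : Submodule R W) (K : Submodule R N), Nonempty (V ≃ₗ[R] N ⧸ K)

namespace Yangian

noncomputable section

/-- `V` is a subquotient of a tensor product `Φ_{z₁} ⊗ ⋯ ⊗ Φ_{zₘ}` of vector modules, `m ≥ 0`. -/
def IsPolynomial (n : ℕ) (V : Type*) [AddCommGroup V] [Module (Yangian n) V] : Prop :=
  ∃ L : List ℂ, IsSubquotient (Yangian n) V
    (YangianRep.tensorList (L.map (YangianRep.vector n))).V

/-- `V` is a subquotient of a tensor product of vector modules (the entries `Sum.inl z`) and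
covector modules (the entries `Sum.inr z`), in any order. -/
def IsRational (n : ℕ) (V : Type*) [AddCommGroup V] [Module (Yangian n) V] : Prop :=
  ∃ L : List (ℂ ⊕ ℂ), IsSubquotient (Yangian n) V
    (YangianRep.tensorList (L.map (Sum.elim (YangianRep.vector n) (YangianRep.covector n)))).V

/-- The element `u` of the field `ℂ((u⁻¹))`, whose uniformizer is `u⁻¹`. -/
def u : LaurentSeries ℂ := HahnSeries.single (-1) 1

/-- `V` has a highest vector `v`, that is `v ≠ 0` and `T_{ij}(u) v = 0` for `i < j`, with
`T_{ii}(u) v = A_i(u) v` for formal power series `A_1(u), …, A_n(u)` in `u⁻¹` such that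
`A_n(u)` is the given series and `A_i(u) / A_{i+1}(u) = P_i(u + 1) / P_i(u)` for `i < n`.
All quotients are taken in `ℂ((u⁻¹))`, and indices are shifted to start at `0`. -/
def HasHighestData {n : ℕ} (hn : 0 < n) (V : Type*) [AddCommGroup V] [Module ℂ V]
    [Module (Yangian n) V] (An : PowerSeries ℂ) (P : Fin (n - 1) → Polynomial ℂ) : Prop :=
  ∃ (v : V) (A : Fin n → PowerSeries ℂ), v ≠ 0 ∧
    (∀ i j : Fin n, i < j → ∀ r, (T i j r : Yangian n) • v = 0) ∧
    (∀ (i : Fin n) (r : ℕ), (T i i r : Yangian n) • v = PowerSeries.coeff r (A i) • v) ∧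
    A ⟨n - 1, by omega⟩ = An ∧
    ∀ i : Fin (n - 1),
      (A ⟨i, by omega⟩ : LaurentSeries ℂ) / (A ⟨i + 1, by omega⟩ : LaurentSeries ℂ)
        = (P i).eval₂ HahnSeries.C (u + 1) / (P i).eval₂ HahnSeries.C u

end

end Yangian

/-! ### Normal ordering of words in the generators. -/

namespace Yangian

variable {n : ℕ}

/-! The two directions are independent of each other.

Necessity uses only the eigenvalue `An` of `T_{nn}(u)`. On a tensor product whose first factor is a
vector or covector module, a filtration by the basis of that factor makes `T_{nn}(u)` act on each
graded piece as on the remaining factors, except that one piece acquires a scalar factor: `1 + 1/(u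
- z)` for a vector module, its inverse for a covector module. These factors are `P(u+1)/P(u)` and
its inverse for `P = u - z`. By induction on the number of factors
(`exists_div_of_hasQuotientEigenvalue`), every eigenvalue of `T_{nn}(u)` on a subquotient is a shift
ratio of a rational function, and of a polynomial when no covector module occurs.

Sufficiency constructs a tensor product with a highest vector of the same weight as `Ψ`. By fusion,
the exterior power `Λᵏ` embeds into the product of vector modules with parameters `z+k-1, …, z`, and
its highest vector has weight `1 + 1/(u - z)` in the first `k` places and `1` in the others
(`realizes_vector`). The top exterior power of covector modules inverts such a factor in all places
at once (`realizes_covector`). The roots of the `P_j` (with `k = j`), of the numerator of `Q_n`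
(with `k = n`) and of its denominator (covectors) together give every `A_i`, since `A_i = A_n ∏_{j ≥
i} P_j(u+1)/P_j(u)` and highest weights multiply under tensor products.

It remains that a simple module with a highest vector is a subquotient of any module with a nonzero
highest vector of equal weight (`isSubquotient_of_isHighest`). This follows from a triangular
spanning set of the Yangian and a grading by a Cartan element. -/

/-- The generator `T_{ij}^{(r+1)}` with label `(i, j, r)`. -/
noncomputable def gen (g : Fin n × Fin n × ℕ) : Yangian n := T g.1 g.2.1 (g.2.2 + 1)

/-- The product of a list of generators. -/
noncomputable def word (l : List (Fin n × Fin n × ℕ)) : Yangian n := (l.map gen).prod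

/-- The total degree of a word, where `T_{ij}^{(r)}` has degree `r`. -/
def wordDegree (l : List (Fin n × Fin n × ℕ)) : ℕ := (l.map fun g => g.2.2 + 1).sum

/-- The span of the words of degree less than `d`. -/
noncomputable def below (n d : ℕ) : Submodule ℂ (Yangian n) :=
  Submodule.span ℂ {y | ∃ l, wordDegree l < d ∧ word l = y}

@[simp] theorem word_nil : word (n := n) [] = 1 := rfl

@[simp] theorem word_cons (g : Fin n × Fin n × ℕ) (l) : word (g :: l) = gen g * word l := by
  simp [word]

@[simp] theorem word_append (l l' : List (Fin n × Fin n × ℕ)) :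
    word (l ++ l') = word l * word l' := by simp [word]

@[simp] theorem wordDegree_nil : wordDegree (n := n) [] = 0 := rfl

@[simp] theorem wordDegree_cons (g : Fin n × Fin n × ℕ) (l) :
    wordDegree (g :: l) = g.2.2 + 1 + wordDegree l := by simp [wordDegree]

@[simp] theorem wordDegree_append (l l' : List (Fin n × Fin n × ℕ)) :
    wordDegree (l ++ l') = wordDegree l + wordDegree l' := by simp [wordDegree]

theorem wordDegree_perm {l l' : List (Fin n × Fin n × ℕ)} (h : l.Perm l') :
    wordDegree l = wordDegree l' := (h.map _).sum_eq

theorem word_mem_below {l : List (Fin n × Fin n × ℕ)} {d : ℕ} (h : wordDegree l < d) :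
    word l ∈ below n d := Submodule.subset_span ⟨l, h, rfl⟩

theorem below_mono {d d' : ℕ} (h : d ≤ d') : below n d ≤ below n d' :=
  Submodule.span_mono fun _ ⟨l, hl, e⟩ => ⟨l, hl.trans_le h, e⟩

theorem mul_mem_below {x y : Yangian n} {a b : ℕ} (hx : x ∈ below n (a + 1)) (hy : y ∈ below n b) :
    x * y ∈ below n (a + b) := by
  have h := Submodule.mul_mem_mul hx hy
  rw [below, below, Submodule.span_mul_span] at h
  refine Submodule.span_mono ?_ h
  rintro _ ⟨_, ⟨l, hl, rfl⟩, _, ⟨l', hl', rfl⟩, rfl⟩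
  exact ⟨l ++ l', by rw [wordDegree_append]; omega, by simp⟩

theorem mul_mem_below' {x y : Yangian n} {a b : ℕ} (hx : x ∈ below n a)
    (hy : y ∈ below n (b + 1)) : x * y ∈ below n (a + b) := by
  have h := Submodule.mul_mem_mul hx hy
  rw [below, below, Submodule.span_mul_span] at h
  refine Submodule.span_mono ?_ h
  rintro _ ⟨_, ⟨l, hl, rfl⟩, _, ⟨l', hl', rfl⟩, rfl⟩
  exact ⟨l ++ l', by rw [wordDegree_append]; omega, by simp⟩

theorem T_zero (i j : Fin n) : (T i j 0 : Yangian n) = if i = j then 1 else 0 :=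
  (isYangianFamily_T n).zero i j

theorem T_mem_below (i j : Fin n) (r : ℕ) : (T i j r : Yangian n) ∈ below n (r + 1) := by
  cases r with
  | zero =>
    rw [T_zero]
    split_ifs
    · exact word_mem_below (l := []) (by simp)
    · exact zero_mem _
  | succ r =>
    have := word_mem_below (l := [(i, j, r)]) (d := r + 1 + 1) (by simp)
    simpa [gen] using this

/-- The defining relation trades `(r + 1, s)` for `(r, s + 1)` up to products of total degree `r +
s`. Repeating it brings the first index to `0`, where the coefficient is a scalar. -/
theorem commutator_mem_below (r : ℕ) : ∀ (i j k l : Fin n) (s : ℕ),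
    (T i j r * T k l s - T k l s * T i j r : Yangian n) ∈ below n (r + s) := by
  induction r with
  | zero =>
    intro i j k l s
    rw [T_zero]
    split_ifs <;> simp
  | succ r ih =>
    intro i j k l s
    have h := (isYangianFamily_T n).rel i j k l r s
    rw [sub_eq_iff_eq_add] at h
    rw [h]
    refine add_mem (sub_mem ?_ ?_) ?_
    · exact below_mono (by omega) (mul_mem_below (T_mem_below k j r) (T_mem_below i l s))
    · exact below_mono (by omega) (mul_mem_below (T_mem_below k j s) (T_mem_below i l r))
    · exact below_mono (by omega) (ih i j k l (s + 1))

theorem word_sub_word_mem_below {l l' : List (Fin n × Fin n × ℕ)} (h : l.Perm l') :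
    word l - word l' ∈ below n (wordDegree l) := by
  induction h with
  | nil => simp
  | cons x h ih =>
    rw [word_cons, word_cons, ← mul_sub, wordDegree_cons]
    exact mul_mem_below (T_mem_below _ _ _) ih
  | swap x y l =>
    have e : word (y :: x :: l) - word (x :: y :: l)
        = (gen y * gen x - gen x * gen y) * word l := by
      simp only [word_cons, sub_mul, mul_assoc]
    rw [e, wordDegree_cons, wordDegree_cons, ← add_assoc]
    exact mul_mem_below' (commutator_mem_below _ _ _ _ _ _) (word_mem_below (Nat.lt_succ_self _))
  | trans h₁ h₂ ih₁ ih₂ =>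
    have := add_mem ih₁ (wordDegree_perm h₁ ▸ ih₂)
    simpa using this

/-- The words in which lower triangular generators precede diagonal ones, and these precede
upper triangular ones. -/
def normalWords (n : ℕ) : Set (Yangian n) :=
  {y | ∃ a b c : List (Fin n × Fin n × ℕ), (∀ g ∈ a, g.2.1 < g.1) ∧ (∀ g ∈ b, g.1 = g.2.1) ∧
    (∀ g ∈ c, g.1 < g.2.1) ∧ y = word a * (word b * word c)}

/-- Sorting the letters changes a word only by terms of lower degree, to which induction applies. No
linear independence is needed, only spanning. -/
theorem word_mem_span_normalWords (d : ℕ) : ∀ l : List (Fin n × Fin n × ℕ), wordDegree l = d →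
    word l ∈ Submodule.span ℂ (normalWords n) := by
  induction d using Nat.strong_induction_on with
  | _ d ih =>
    intro l hl
    set a := l.filter fun g => g.2.1 < g.1
    set m := l.filter fun g => !decide (g.2.1 < g.1)
    set b := m.filter fun g => g.1 = g.2.1
    set c := m.filter fun g => !decide (g.1 = g.2.1)
    have h₁ : (a ++ m).Perm l := List.filter_append_perm _ l
    have h₂ : (b ++ c).Perm m := List.filter_append_perm _ m
    have h : l.Perm (a ++ (b ++ c)) := ((h₂.append_left a).trans h₁).symm
    have hb : below n d ≤ Submodule.span ℂ (normalWords n) := by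
      refine Submodule.span_le.2 ?_
      rintro _ ⟨l', hl', rfl⟩
      exact ih _ hl' l' rfl
    have h₃ := hb (hl ▸ word_sub_word_mem_below h)
    rw [← sub_add_cancel (word l) (word (a ++ (b ++ c)))]
    refine add_mem h₃ (Submodule.subset_span ⟨a, b, c, ?_, ?_, ?_, by simp⟩)
    · intro g hg; simpa using (List.mem_filter.1 hg).2
    · intro g hg; simpa using (List.mem_filter.1 hg).2
    · intro g hg
      have h4 := List.mem_filter.1 hg
      have h5 := (List.mem_filter.1 h4.1).2
      have h6 := h4.2
      simp only [Bool.not_eq_true', decide_eq_false_iff_not, not_lt] at h5 h6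
      exact lt_of_le_of_ne h5 h6

theorem adjoin_range_gen : Algebra.adjoin ℂ (Set.range (gen (n := n))) = ⊤ := by
  have h : (mk n : FreeAlgebra ℂ (Fin n × Fin n × ℕ) → Yangian n) ∘ FreeAlgebra.ι ℂ = gen := by
    ext ⟨i, j, r⟩
    rfl
  rw [← h, Set.range_comp, ← AlgHom.map_adjoin, FreeAlgebra.adjoin_range_ι, Algebra.map_top]
  exact (AlgHom.range_eq_top _).2 (RingQuot.mkAlgHom_surjective ℂ _)

theorem span_normalWords : Submodule.span ℂ (normalWords n) = ⊤ := by
  rw [eq_top_iff, ← Algebra.top_toSubmodule, ← adjoin_range_gen, Algebra.adjoin_eq_span]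
  refine Submodule.span_le.2 fun y hy => ?_
  suffices ∃ l, word l = y by
    obtain ⟨l, rfl⟩ := this
    exact word_mem_span_normalWords _ l rfl
  induction hy using Submonoid.closure_induction with
  | mem x hx => obtain ⟨g, rfl⟩ := hx; exact ⟨[g], by simp⟩
  | one => exact ⟨[], rfl⟩
  | mul x y _ _ hx hy =>
    obtain ⟨l, rfl⟩ := hx
    obtain ⟨l', rfl⟩ := hy
    exact ⟨l ++ l', by simp⟩

/-! ### Highest vectors and the comparison of modules of equal highest weight. -/

/-- `v` is annihilated by all `T_{ij}(u)` with `i < j`, and `T_{ii}(u) v = a_i(u) v`. -/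
structure IsHighest {V : Type*} [AddCommGroup V] [Module ℂ V] [Module (Yangian n) V]
    (v : V) (a : Fin n → PowerSeries ℂ) : Prop where
  upper : ∀ i j : Fin n, i < j → ∀ r, (T i j r : Yangian n) • v = 0
  diag : ∀ (i : Fin n) (r : ℕ), (T i i r : Yangian n) • v = PowerSeries.coeff r (a i) • v

/-- A Cartan element with which `T_{ij}(u)` has commutator `(j - i) T_{ij}(u)`. -/
noncomputable def grading (n : ℕ) : Yangian n := ∑ i : Fin n, (-(i : ℂ)) • T i i 1

/-- The relation with `r = 0` gives `[T_{ii}^{(1)}, T_{kl}(v)] = (δ_{ik} - δ_{il}) T_{kl}(v)`,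
because zeroth coefficients are scalars. Thus lower triangular generators strictly lower the weight
by a positive integer. -/
theorem grading_comm (k l : Fin n) (s : ℕ) :
    grading n * T k l s - T k l s * grading n = ((l : ℂ) - k) • T k l s := by
  have h : ∀ i : Fin n, (T i i 1 * T k l s - T k l s * T i i 1 : Yangian n)
      = (if i = k then T k l s else 0) - if i = l then T k l s else 0 := by
    intro i
    have := (isYangianFamily_T n).rel i i k l 0 s
    have h1 : ∀ y : Yangian n, T i i 0 * y - y * T i i 0 = 0 := by
      intro y; rw [T_zero]; simp
    rw [h1, sub_zero, zero_add] at this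
    rw [this, T_zero, T_zero]
    simp only [ite_mul, mul_ite, one_mul, zero_mul, mul_one, mul_zero, @eq_comm _ k i]
    congr 1
    · split_ifs with h <;> simp [h]
    · split_ifs with h <;> simp [h]
  simp only [grading, Finset.sum_mul, Finset.mul_sum, smul_mul_assoc, mul_smul_comm]
  rw [← Finset.sum_sub_distrib]
  simp only [← smul_sub, h]
  simp only [smul_sub, smul_ite, smul_zero, Finset.sum_sub_distrib, Finset.sum_ite_eq',
    Finset.mem_univ, if_true]
  module

section Highest

variable {V : Type*} [AddCommGroup V] [Module ℂ V] [Module (Yangian n) V]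
  [IsScalarTower ℂ (Yangian n) V] {v : V} {a : Fin n → PowerSeries ℂ}

/-- The eigenvalue of the grading element on a highest vector. -/
noncomputable def gradingWeight (a : Fin n → PowerSeries ℂ) : ℂ :=
  ∑ i : Fin n, (-(i : ℂ)) * PowerSeries.coeff 1 (a i)

theorem IsHighest.grading_smul (h : IsHighest v a) : grading n • v = gradingWeight a • v := by
  simp only [grading, gradingWeight, Finset.sum_smul, smul_assoc, h.diag, mul_smul]

/-- The scalar by which a product of diagonal generators acts on a highest vector. -/
noncomputable def diagonalScalar (a : Fin n → PowerSeries ℂ) (b : List (Fin n × Fin n × ℕ)) : ℂ :=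
  (b.map fun g => PowerSeries.coeff (g.2.2 + 1) (a g.1)).prod

theorem IsHighest.word_diag_smul (h : IsHighest v a) (b : List (Fin n × Fin n × ℕ))
    (hb : ∀ g ∈ b, g.1 = g.2.1) : word b • v = diagonalScalar a b • v := by
  induction b with
  | nil => simp [diagonalScalar]
  | cons g b ih =>
    rw [word_cons, mul_smul, ih fun g hg => hb g (List.mem_cons_of_mem _ hg), smul_algebra_smul_comm,
      gen, ← hb g List.mem_cons_self, h.diag, smul_smul]
    simp [diagonalScalar, mul_comm]

theorem IsHighest.word_upper_smul (h : IsHighest v a) (c : List (Fin n × Fin n × ℕ))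
    (hc : ∀ g ∈ c, g.1 < g.2.1) : word c • v = (if c = [] then (1 : ℂ) else 0) • v := by
  induction c with
  | nil => simp
  | cons g c ih =>
    rw [word_cons, mul_smul, ih fun g hg => hc g (List.mem_cons_of_mem _ hg), smul_algebra_smul_comm,
      gen, h.upper _ _ (hc g List.mem_cons_self)]
    simp

/-- The action of the grading element, as a complex linear operator. -/
noncomputable def gradingEnd (n : ℕ) (V : Type*) [AddCommGroup V] [Module ℂ V]
    [Module (Yangian n) V] [IsScalarTower ℂ (Yangian n) V] : Module.End ℂ V :=
  Algebra.lsmul ℂ ℂ V (grading n)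

theorem gradingEnd_apply (w : V) : gradingEnd n V w = grading n • w := rfl

theorem IsHighest.word_lower_smul (h : IsHighest v a) (l : List (Fin n × Fin n × ℕ))
    (hl : ∀ g ∈ l, g.2.1 < g.1) : ∃ m : ℕ, l.length ≤ m ∧
      word l • v ∈ (gradingEnd n V).eigenspace (gradingWeight a - m) := by
  induction l with
  | nil => exact ⟨0, le_rfl, by simp [gradingEnd_apply, h.grading_smul]⟩
  | cons g l ih =>
    obtain ⟨m, hm, ih⟩ := ih fun g hg => hl g (List.mem_cons_of_mem _ hg)
    have hg : (g.2.1 : ℕ) < g.1 := hl g List.mem_cons_self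
    refine ⟨m + (g.1 - g.2.1), by simp only [List.length_cons]; omega, ?_⟩
    rw [Module.End.mem_eigenspace_iff, gradingEnd_apply] at ih ⊢
    have hc := grading_comm g.1 g.2.1 (g.2.2 + 1)
    rw [sub_eq_iff_eq_add] at hc
    rw [word_cons, mul_smul, gen, ← mul_smul, hc, add_smul, mul_smul, ih, smul_assoc,
      smul_algebra_smul_comm, ← add_smul, Nat.cast_add, Nat.cast_sub hg.le]
    congr 1
    ring

/-- The span of the vectors of weights strictly below the highest one. -/
noncomputable def lowerSpace (n : ℕ) (V : Type*) [AddCommGroup V] [Module ℂ V]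
    [Module (Yangian n) V] [IsScalarTower ℂ (Yangian n) V] (c : ℂ) : Submodule ℂ V :=
  ⨆ m : ℕ, (gradingEnd n V).eigenspace (c - (m + 1 : ℕ))

/-- Eigenspaces for distinct eigenvalues are independent, and the highest eigenvalue is none of
those that make up `lowerSpace`. -/
theorem IsHighest.eq_zero_of_mem_lowerSpace (h : IsHighest v a) {c : ℂ}
    (hc : c • v ∈ lowerSpace n V (gradingWeight a)) : c • v = 0 := by
  have hd := (gradingEnd n V).eigenspaces_iSupIndep (gradingWeight a)
  refine Submodule.disjoint_def.1 hd _ (Submodule.smul_mem _ _ ?_) (?_ : c • v ∈ _)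
  · rw [Module.End.mem_eigenspace_iff, gradingEnd_apply, h.grading_smul]
  · refine (iSup_le fun m => ?_ : lowerSpace n V (gradingWeight a) ≤ _) hc
    refine le_iSup₂_of_le (gradingWeight a - (m + 1 : ℕ)) ?_ le_rfl
    intro e
    rw [sub_eq_self] at e
    exact Nat.cast_ne_zero.2 (Nat.succ_ne_zero m) e

/-- The scalar by which a product of diagonal and upper triangular generators acts on a highest
vector. -/
noncomputable def normalScalar (a : Fin n → PowerSeries ℂ) (b c : List (Fin n × Fin n × ℕ)) : ℂ :=
  diagonalScalar a b * if c = [] then 1 else 0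

theorem IsHighest.normalWord_smul (h : IsHighest v a) (l : List (Fin n × Fin n × ℕ))
    {b c : List (Fin n × Fin n × ℕ)} (hb : ∀ g ∈ b, g.1 = g.2.1) (hc : ∀ g ∈ c, g.1 < g.2.1) :
    (word l * (word b * word c)) • v = normalScalar a b c • word l • v := by
  rw [mul_smul, mul_smul, h.word_upper_smul c hc, smul_algebra_smul_comm,
    h.word_diag_smul b hb, smul_smul, smul_algebra_smul_comm, mul_comm, normalScalar]

/-- The point is that one scalar `χ` serves both modules: on a normal word it is read off from the
word and the weight `a` alone. -/
theorem exists_scalar_of_isHighest {W : Type*} [AddCommGroup W] [Module ℂ W] [Module (Yangian n) W]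
    [IsScalarTower ℂ (Yangian n) W] {w : W} (hv : IsHighest v a) (hw : IsHighest w a)
    (y : Yangian n) : ∃ χ : ℂ, y • v - χ • v ∈ lowerSpace n V (gradingWeight a) ∧
      y • w - χ • w ∈ lowerSpace n W (gradingWeight a) := by
  have hy : y ∈ Submodule.span ℂ (normalWords n) := span_normalWords ▸ Submodule.mem_top
  induction hy using Submodule.span_induction with
  | mem y hy =>
    obtain ⟨l, b, c, hl, hb, hc, rfl⟩ := hy
    rcases Nat.eq_zero_or_pos l.length with h0 | h0
    · obtain rfl := List.length_eq_zero_iff.1 h0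
      refine ⟨normalScalar a b c, ?_, ?_⟩
      · rw [hv.normalWord_smul [] hb hc, word_nil, one_smul, sub_self]; exact zero_mem _
      · rw [hw.normalWord_smul [] hb hc, word_nil, one_smul, sub_self]; exact zero_mem _
    -- A nonempty lower triangular part pushes the vector into strictly lower weights, so it
    -- contributes nothing to the scalar.
    · refine ⟨0, ?_, ?_⟩
      · obtain ⟨m, hm, h⟩ := hv.word_lower_smul l hl
        obtain ⟨m, rfl⟩ := Nat.exists_eq_succ_of_ne_zero (by omega : m ≠ 0)
        rw [hv.normalWord_smul l hb hc, zero_smul, sub_zero]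
        exact Submodule.smul_mem _ _ (Submodule.mem_iSup_of_mem m h)
      · obtain ⟨m, hm, h⟩ := hw.word_lower_smul l hl
        obtain ⟨m, rfl⟩ := Nat.exists_eq_succ_of_ne_zero (by omega : m ≠ 0)
        rw [hw.normalWord_smul l hb hc, zero_smul, sub_zero]
        exact Submodule.smul_mem _ _ (Submodule.mem_iSup_of_mem m h)
  | zero => exact ⟨0, by simp, by simp⟩
  | add y z _ _ hy hz =>
    obtain ⟨χ, h₁, h₂⟩ := hy
    obtain ⟨χ', h₁', h₂'⟩ := hz
    refine ⟨χ + χ', ?_, ?_⟩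
    · convert add_mem h₁ h₁' using 1
      rw [add_smul, add_smul]; abel
    · convert add_mem h₂ h₂' using 1
      rw [add_smul, add_smul]; abel
  | smul c y _ hy =>
    obtain ⟨χ, h₁, h₂⟩ := hy
    refine ⟨c * χ, ?_, ?_⟩
    · convert Submodule.smul_mem _ c h₁ using 1
      rw [smul_sub, smul_assoc, mul_smul]
    · convert Submodule.smul_mem _ c h₂ using 1
      rw [smul_sub, smul_assoc, mul_smul]

/-- A simple module with a highest vector is a subquotient of every module with a nonzero
highest vector of the same weight. -/
theorem isSubquotient_of_isHighest {W : Type*} [AddCommGroup W] [Module ℂ W]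
    [Module (Yangian n) W] [IsScalarTower ℂ (Yangian n) W] {w : W} [IsSimpleModule (Yangian n) V]
    (hv0 : v ≠ 0) (hw0 : w ≠ 0) (hv : IsHighest v a) (hw : IsHighest w a) :
    IsSubquotient (Yangian n) V W := by
  set f := LinearMap.toSpanSingleton (Yangian n) V v
  set g := LinearMap.toSpanSingleton (Yangian n) W w
  have hf : Function.Surjective f := IsSimpleModule.toSpanSingleton_surjective _ hv0
  -- If `y` killed `w` but not `v`, simplicity would give `y'` with `y' y v = v`, while `y' y w =
  -- 0`. The common scalar of `y' y` would then be both `1` and `0`.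
  have hk : LinearMap.ker g ≤ LinearMap.ker f := by
    intro y hy
    by_contra hyv
    have hyw : y • w = 0 := hy
    obtain ⟨y', hy'⟩ := IsSimpleModule.toSpanSingleton_surjective (Yangian n) hyv v
    have hy' : (y' * y) • v = v := by rw [mul_smul]; exact hy'
    obtain ⟨χ, h₁, h₂⟩ := exists_scalar_of_isHighest hv hw (y' * y)
    rw [hy', show v - χ • v = (1 - χ) • v by rw [sub_smul, one_smul]] at h₁
    rw [mul_smul, hyw, smul_zero, zero_sub, ← neg_smul] at h₂
    have h₁ := (smul_eq_zero.1 (hv.eq_zero_of_mem_lowerSpace h₁)).resolve_right hv0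
    have h₂ := (smul_eq_zero.1 (hw.eq_zero_of_mem_lowerSpace h₂)).resolve_right hw0
    rw [neg_eq_zero.1 h₂, sub_zero] at h₁
    exact one_ne_zero h₁
  set p : LinearMap.range g →ₗ[Yangian n] V :=
    (LinearMap.ker g).liftQ f hk ∘ₗ g.quotKerEquivRange.symm.toLinearMap
  have hp : Function.Surjective p := by
    intro x
    obtain ⟨y, rfl⟩ := hf x
    exact ⟨g.quotKerEquivRange (Submodule.Quotient.mk y), by simp [p]⟩
  exact ⟨LinearMap.range g, LinearMap.ker p, ⟨(p.quotKerEquivOfSurjective hp).symm⟩⟩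

end Highest

end Yangian

/-! ### Shift ratios `P(u+1)/P(u)` in `ℂ((u⁻¹))`. -/

namespace Yangian

theorem X_mul_u : ((PowerSeries.X : PowerSeries ℂ) : LaurentSeries ℂ) * u = 1 := by
  rw [PowerSeries.coe_X, u, HahnSeries.single_mul_single]
  simp

theorem u_sub_C_ne_zero (z : ℂ) : u - HahnSeries.C z ≠ 0 := by
  intro h
  have := congrArg (fun f : LaurentSeries ℂ => f.coeff (-1)) h
  simp [u, HahnSeries.C_apply] at this

/-- The quotient `P(u + 1) / P(u)` in `ℂ((u⁻¹))`. -/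
noncomputable def shiftRatio (P : Polynomial ℂ) : LaurentSeries ℂ :=
  P.eval₂ HahnSeries.C (u + 1) / P.eval₂ HahnSeries.C u

theorem eval₂_u_add_ne_zero (c : ℂ) {P : Polynomial ℂ} (hP : P ≠ 0) :
    P.eval₂ HahnSeries.C (u + HahnSeries.C c) ≠ 0 := by
  rw [(IsAlgClosed.splits P).eq_prod_roots, Polynomial.eval₂_mul, Polynomial.eval₂_C,
    Polynomial.eval₂_multiset_prod, Multiset.map_map]
  refine mul_ne_zero ((map_ne_zero HahnSeries.C).2 (Polynomial.leadingCoeff_ne_zero.2 hP)) ?_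
  rw [Ne, Multiset.prod_eq_zero_iff, Multiset.mem_map]
  rintro ⟨z, -, hz⟩
  refine u_sub_C_ne_zero (z - c) ?_
  simp only [Function.comp, Polynomial.eval₂_sub, Polynomial.eval₂_X, Polynomial.eval₂_C] at hz
  rw [← hz, map_sub]
  ring

theorem eval₂_u_ne_zero {P : Polynomial ℂ} (hP : P ≠ 0) : P.eval₂ HahnSeries.C u ≠ 0 := by
  simpa using eval₂_u_add_ne_zero 0 hP

theorem eval₂_u_add_one_ne_zero {P : Polynomial ℂ} (hP : P ≠ 0) :
    P.eval₂ HahnSeries.C (u + 1) ≠ 0 := by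
  simpa using eval₂_u_add_ne_zero 1 hP

theorem shiftRatio_mul (P Q : Polynomial ℂ) :
    shiftRatio (P * Q) = shiftRatio P * shiftRatio Q := by
  simp only [shiftRatio, Polynomial.eval₂_mul, mul_div_mul_comm]

theorem shiftRatio_one : shiftRatio 1 = 1 := by simp [shiftRatio]

theorem shiftRatio_C {c : ℂ} (hc : c ≠ 0) : shiftRatio (Polynomial.C c) = 1 := by
  simp [shiftRatio, hc]

theorem shiftRatio_ne_zero {P : Polynomial ℂ} (hP : P ≠ 0) : shiftRatio P ≠ 0 :=
  div_ne_zero (eval₂_u_add_one_ne_zero hP) (eval₂_u_ne_zero hP)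

/-- The series `1 + c (u - y)⁻¹`. -/
noncomputable def evalSeries (y c : ℂ) : PowerSeries ℂ :=
  PowerSeries.mk fun r => Nat.casesOn r 1 fun r => y ^ r * c

theorem evalSeries_mul (y c : ℂ) :
    evalSeries y c * (1 - PowerSeries.C y * PowerSeries.X)
      = 1 - PowerSeries.C y * PowerSeries.X + PowerSeries.C c * PowerSeries.X := by
  ext r
  rw [mul_sub, mul_one, mul_left_comm]
  rcases r with _ | _ | r
  · simp [evalSeries]
  · simp [evalSeries, PowerSeries.coeff_one, PowerSeries.coeff_succ_mul_X]
    ring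
  · simp [evalSeries, PowerSeries.coeff_one, PowerSeries.coeff_succ_mul_X]
    ring

theorem coe_evalSeries (y c : ℂ) : (evalSeries y c : LaurentSeries ℂ)
    = (u - HahnSeries.C y + HahnSeries.C c) / (u - HahnSeries.C y) := by
  rw [eq_div_iff (u_sub_C_ne_zero y)]
  have h := congrArg (fun f : PowerSeries ℂ => (f : LaurentSeries ℂ) * u) (evalSeries_mul y c)
  simp only [PowerSeries.coe_mul, PowerSeries.coe_sub, PowerSeries.coe_add, PowerSeries.coe_C,
    PowerSeries.coe_one] at h
  linear_combination h + (HahnSeries.C y * (evalSeries y c : LaurentSeries ℂ) - HahnSeries.C y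
    + HahnSeries.C c) * X_mul_u

theorem shiftRatio_X_sub_C (z : ℂ) :
    shiftRatio (Polynomial.X - Polynomial.C z) = (evalSeries z 1 : LaurentSeries ℂ) := by
  rw [coe_evalSeries, shiftRatio]
  simp only [Polynomial.eval₂_sub, Polynomial.eval₂_X, Polynomial.eval₂_C, map_one]
  congr 1
  ring

theorem shiftRatio_X_sub_C_inv (z : ℂ) : (shiftRatio (Polynomial.X - Polynomial.C z))⁻¹
    = (evalSeries (z - 1) (-1) : LaurentSeries ℂ) := by
  rw [coe_evalSeries, shiftRatio, inv_div]
  simp only [Polynomial.eval₂_sub, Polynomial.eval₂_X, Polynomial.eval₂_C, map_one, map_sub,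
    map_neg]
  congr 1 <;> ring

/-- The leading coefficient cancels, and each root `z` leaves the factor `1 + 1/(u - z)` that a
vector module with parameter `z` produces. -/
theorem shiftRatio_eq_prod_roots {P : Polynomial ℂ} (hP : P ≠ 0) :
    shiftRatio P = (P.roots.map fun z => (evalSeries z 1 : LaurentSeries ℂ)).prod := by
  conv_lhs => rw [(IsAlgClosed.splits P).eq_prod_roots]
  rw [shiftRatio_mul, shiftRatio_C (Polynomial.leadingCoeff_ne_zero.2 hP), one_mul]
  induction P.roots using Multiset.induction with
  | empty => simp [shiftRatio_one]
  | cons z s ih => simp only [Multiset.map_cons, Multiset.prod_cons, shiftRatio_mul, ih,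
      shiftRatio_X_sub_C]

/-- `RatFunc.eval` uses the reduced numerator and denominator, which may differ from `p` and `q`.
Multiplicativity of `shiftRatio` on `num * q = p * denom` removes the difference. -/
theorem ratFunc_eval_div {p q : Polynomial ℂ} (hq : q ≠ 0) :
    (algebraMap _ (RatFunc ℂ) p / algebraMap _ (RatFunc ℂ) q).eval HahnSeries.C (u + 1)
      / (algebraMap _ (RatFunc ℂ) p / algebraMap _ (RatFunc ℂ) q).eval HahnSeries.C u
      = shiftRatio p / shiftRatio q := by
  set f := algebraMap _ (RatFunc ℂ) p / algebraMap _ (RatFunc ℂ) q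
  have hf : f.num * q = p * f.denom := by
    exact (RatFunc.num_mul_eq_mul_denom_iff hq).2 rfl
  have h := congrArg shiftRatio hf
  rw [shiftRatio_mul, shiftRatio_mul] at h
  rw [RatFunc.eval, RatFunc.eval, div_div_div_comm, ← shiftRatio, ← shiftRatio,
    div_eq_div_iff (shiftRatio_ne_zero f.denom_ne_zero) (shiftRatio_ne_zero hq), h]

end Yangian

/-! ### Operators on tensor products, highest vectors and intertwiners. -/

namespace Yangian

open Finset.HasAntidiagonal

variable {n : ℕ}

section Families

variable {V W U : Type*} [AddCommGroup V] [Module ℂ V] [AddCommGroup W] [Module ℂ W]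
  [AddCommGroup U] [Module ℂ U]

/-- The operators by which `T_{ij}(u)` acts on a tensor product. -/
noncomputable def tensorFamily (s : Fin n → Fin n → ℕ → Module.End ℂ V)
    (t : Fin n → Fin n → ℕ → Module.End ℂ W) (i j : Fin n) (r : ℕ) : Module.End ℂ (V ⊗[ℂ] W) :=
  ∑ k, ∑ p ∈ antidiagonal r, TensorProduct.map (s i k p.1) (t k j p.2)

theorem tensorFamily_tmul (s : Fin n → Fin n → ℕ → Module.End ℂ V)
    (t : Fin n → Fin n → ℕ → Module.End ℂ W) (i j : Fin n) (r : ℕ) (x : V) (y : W) :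
    tensorFamily s t i j r (x ⊗ₜ y)
      = ∑ k, ∑ p ∈ antidiagonal r, s i k p.1 x ⊗ₜ t k j p.2 y := by
  simp [tensorFamily, LinearMap.sum_apply]

/-- The operators by which `T_{ij}(u)` acts on the trivial module. -/
def trivFamily (i j : Fin n) : ℕ → Module.End ℂ ℂ
  | 0 => if i = j then 1 else 0
  | _ + 1 => 0

/-- The vector `v` is highest of weight `a` with respect to the operators `t i j r`. -/
structure IsHighestFor (t : Fin n → Fin n → ℕ → Module.End ℂ V) (v : V)
    (a : Fin n → PowerSeries ℂ) : Prop where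
  upper : ∀ i j : Fin n, i < j → ∀ r, t i j r v = 0
  diag : ∀ (i : Fin n) (r : ℕ), t i i r v = PowerSeries.coeff r (a i) • v

/-- In `∑ₖ T_{ik}(u) x ⊗ T_{kj}(u) y` with `i < j`, every `k` satisfies `i < k` or `k < j`, so some
factor vanishes. For `i = j` only `k = i` survives. -/
theorem IsHighestFor.tmul {s : Fin n → Fin n → ℕ → Module.End ℂ V}
    {t : Fin n → Fin n → ℕ → Module.End ℂ W} {x : V} {y : W} {a b : Fin n → PowerSeries ℂ}
    (hx : IsHighestFor s x a) (hy : IsHighestFor t y b) :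
    IsHighestFor (tensorFamily s t) (x ⊗ₜ y) (fun i => a i * b i) where
  upper i j hij r := by
    rw [tensorFamily_tmul]
    refine Finset.sum_eq_zero fun k _ => Finset.sum_eq_zero fun p _ => ?_
    rcases lt_or_ge i k with h | h
    · rw [hx.upper i k h, TensorProduct.zero_tmul]
    · rw [hy.upper k j (h.trans_lt hij), TensorProduct.tmul_zero]
  diag i r := by
    rw [tensorFamily_tmul, Finset.sum_eq_single i, PowerSeries.coeff_mul, Finset.sum_smul]
    · refine Finset.sum_congr rfl fun p _ => ?_
      rw [hx.diag, hy.diag, TensorProduct.smul_tmul_smul]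
    · intro k _ hk
      refine Finset.sum_eq_zero fun p _ => ?_
      rcases lt_or_gt_of_ne hk with h | h
      · rw [hy.upper k i h, TensorProduct.tmul_zero]
      · rw [hx.upper i k h, TensorProduct.zero_tmul]
    · simp

theorem isHighestFor_triv : IsHighestFor (trivFamily (n := n)) (1 : ℂ) fun _ => 1 where
  upper i j hij r := by cases r <;> simp [trivFamily, hij.ne]
  diag i r := by cases r <;> simp [trivFamily, PowerSeries.coeff_one]

/-- The linear map `f` commutes with the operators `t i j r`. -/
def Intertwines (s : Fin n → Fin n → ℕ → Module.End ℂ V)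
    (t : Fin n → Fin n → ℕ → Module.End ℂ W) (f : V →ₗ[ℂ] W) : Prop :=
  ∀ i j r, f ∘ₗ s i j r = t i j r ∘ₗ f

theorem Intertwines.isHighestFor {s : Fin n → Fin n → ℕ → Module.End ℂ V}
    {t : Fin n → Fin n → ℕ → Module.End ℂ W} {f : V →ₗ[ℂ] W} (hf : Intertwines s t f)
    {x : V} {a : Fin n → PowerSeries ℂ} (h : IsHighestFor s x a) : IsHighestFor t (f x) a where
  upper i j hij r := by
    rw [← LinearMap.comp_apply, ← hf, LinearMap.comp_apply, h.upper i j hij, map_zero]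
  diag i r := by rw [← LinearMap.comp_apply, ← hf, LinearMap.comp_apply, h.diag, map_smul]

theorem Intertwines.comp {s : Fin n → Fin n → ℕ → Module.End ℂ V}
    {t : Fin n → Fin n → ℕ → Module.End ℂ W} {q : Fin n → Fin n → ℕ → Module.End ℂ U}
    {f : V →ₗ[ℂ] W} {g : W →ₗ[ℂ] U}
    (hg : Intertwines t q g) (hf : Intertwines s t f) : Intertwines s q (g ∘ₗ f) :=
  fun i j r => by rw [LinearMap.comp_assoc, hf, ← LinearMap.comp_assoc, hg, LinearMap.comp_assoc]

theorem Intertwines.lTensor (s : Fin n → Fin n → ℕ → Module.End ℂ V)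
    {t : Fin n → Fin n → ℕ → Module.End ℂ W} {q : Fin n → Fin n → ℕ → Module.End ℂ U}
    {f : W →ₗ[ℂ] U} (hf : Intertwines t q f) :
    Intertwines (tensorFamily s t) (tensorFamily s q) (f.lTensor V) := by
  intro i j r
  refine TensorProduct.ext' fun x y => ?_
  have h : ∀ i j r y, f (t i j r y) = q i j r (f y) := fun i j r y => LinearMap.congr_fun (hf i j r) y
  simp only [LinearMap.comp_apply, tensorFamily_tmul, LinearMap.lTensor_tmul, map_sum, h]

theorem intertwines_lid (t : Fin n → Fin n → ℕ → Module.End ℂ W) :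
    Intertwines (tensorFamily trivFamily t) t (TensorProduct.lid ℂ W).toLinearMap := by
  intro i j r
  refine TensorProduct.ext' fun x y => ?_
  simp only [LinearMap.comp_apply, tensorFamily_tmul, LinearEquiv.coe_coe, map_sum,
    TensorProduct.lid_tmul, map_smul]
  rw [Finset.sum_eq_single i, Finset.sum_eq_single (0, r)]
  · simp [trivFamily]
  · rintro ⟨_ | p, q⟩ hp hne
    · exact absurd (by simpa using mem_antidiagonal.1 hp) hne
    · simp [trivFamily]
  · simp [mem_antidiagonal]
  · intro k _ hk
    refine Finset.sum_eq_zero ?_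
    rintro ⟨_ | p, q⟩ _ <;> simp [trivFamily, hk.symm]
  · simp

theorem sum_antidiagonal_assoc {A : Type*} [AddCommMonoid A] (f : ℕ → ℕ → ℕ → A) (r : ℕ) :
    ∑ p ∈ antidiagonal r, ∑ q ∈ antidiagonal p.1, f q.1 q.2 p.2
      = ∑ p ∈ antidiagonal r, ∑ q ∈ antidiagonal p.2, f p.1 q.1 q.2 := by
  rw [Finset.sum_sigma', Finset.sum_sigma']
  refine Finset.sum_nbij' (fun x => ⟨(x.2.1, x.2.2 + x.1.2), (x.2.2, x.1.2)⟩)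
    (fun x => ⟨(x.1.1 + x.2.1, x.2.2), (x.1.1, x.2.1)⟩) ?_ ?_ ?_ ?_ (fun _ _ => rfl)
  · rintro ⟨⟨a, b⟩, ⟨c, d⟩⟩ h
    simp only [Finset.mem_sigma, mem_antidiagonal] at h ⊢
    exact ⟨by rw [← h.1, ← h.2, add_assoc], trivial⟩
  · rintro ⟨⟨a, b⟩, ⟨c, d⟩⟩ h
    simp only [Finset.mem_sigma, mem_antidiagonal] at h ⊢
    exact ⟨by rw [← h.1, ← h.2, add_assoc], trivial⟩
  · rintro ⟨⟨a, b⟩, ⟨c, d⟩⟩ h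
    simp only [Finset.mem_sigma, mem_antidiagonal] at h ⊢
    obtain ⟨-, rfl⟩ := h
    rfl
  · rintro ⟨⟨a, b⟩, ⟨c, d⟩⟩ h
    simp only [Finset.mem_sigma, mem_antidiagonal] at h ⊢
    obtain ⟨-, rfl⟩ := h
    rfl

theorem intertwines_assoc (s : Fin n → Fin n → ℕ → Module.End ℂ V)
    (t : Fin n → Fin n → ℕ → Module.End ℂ W) (q : Fin n → Fin n → ℕ → Module.End ℂ U) :
    Intertwines (tensorFamily (tensorFamily s t) q) (tensorFamily s (tensorFamily t q))
      (TensorProduct.assoc ℂ V W U).toLinearMap := by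
  intro i j r
  refine TensorProduct.ext_threefold fun x y z => ?_
  simp only [LinearMap.comp_apply, tensorFamily_tmul, LinearEquiv.coe_coe, map_sum,
    TensorProduct.assoc_tmul, TensorProduct.sum_tmul, TensorProduct.tmul_sum]
  rw [Finset.sum_congr rfl fun k _ => Finset.sum_comm, Finset.sum_comm]
  refine Finset.sum_congr rfl fun l _ => ?_
  rw [Finset.sum_comm (s := antidiagonal r) (t := Finset.univ)]
  refine Finset.sum_congr rfl fun k _ => ?_
  exact sum_antidiagonal_assoc (fun a b c => s i l a x ⊗ₜ[ℂ] (t l k b y ⊗ₜ[ℂ] q k j c z)) r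

theorem tmul_ne_zero {x : V} {y : W} (hx : x ≠ 0) (hy : y ≠ 0) : x ⊗ₜ[ℂ] y ≠ 0 := by
  obtain ⟨f, hf⟩ : ∃ f : Module.Dual ℂ V, f x ≠ 0 := by
    by_contra! h
    exact hx ((Module.forall_dual_apply_eq_zero_iff ℂ x).1 h)
  intro h
  have := congrArg (fun z => TensorProduct.lid ℂ W (f.rTensor W z)) h
  simp only [LinearMap.rTensor_tmul, TensorProduct.lid_tmul, map_zero, smul_eq_zero] at this
  exact this.elim hf hy

end Families

end Yangian

/-! ### Concatenation of tensor products and the weights they realize. -/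

namespace YangianRep

open Yangian Finset.HasAntidiagonal

variable {n : ℕ}

theorem smul_def (M : YangianRep n) (y : Yangian n) (x : M.V) : y • x = M.ρ y x := rfl

instance (M : YangianRep n) : IsScalarTower ℂ (Yangian n) M.V where
  smul_assoc c y x := by rw [smul_def, smul_def, map_smul, LinearMap.smul_apply]

/-- The operators by which the generators act. -/
noncomputable def family (M : YangianRep n) (i j : Fin n) (r : ℕ) : Module.End ℂ M.V := M.ρ (T i j r)

theorem family_triv : (triv n).family = trivFamily (n := n) := by
  funext i j r
  change (Algebra.ofId ℂ (Module.End ℂ ℂ)) (counit n (T i j r)) = _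
  rw [counit, lift_T]
  cases r with
  | zero => simp only [trivFamily, if_true]; split_ifs <;> simp
  | succ r => simp [trivFamily]

theorem family_tensor (M N : YangianRep n) :
    (tensor M N).family = tensorFamily M.family N.family := by
  funext i j r
  change Module.endTensorEndAlgHom (R := ℂ) (A := ℂ) (M := M.V) (N := N.V)
    (Algebra.TensorProduct.map M.ρ N.ρ (comul n (T i j r))) = _
  rw [comul, lift_T]
  simp only [map_sum, Algebra.TensorProduct.map_tmul]
  rfl

/-- `tensorList` is nested to the right, so concatenation is the unit isomorphism followed by
repeated reassociation. Injectivity is all that is needed to keep a highest vector nonzero. -/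
theorem exists_intertwiner_append (L L' : List (YangianRep n)) :
    ∃ f : (tensorList L).V ⊗[ℂ] (tensorList L').V →ₗ[ℂ] (tensorList (L ++ L')).V,
      Function.Injective f ∧ Intertwines (tensorFamily (tensorList L).family (tensorList L').family)
        (tensorList (L ++ L')).family f := by
  induction L with
  | nil =>
    refine ⟨_, (TensorProduct.lid ℂ (tensorList L').V).injective, ?_⟩
    have := intertwines_lid (tensorList L').family
    rw [← family_triv] at this
    exact this
  | cons M L ih =>
    obtain ⟨f, hf, h⟩ := ih
    refine ⟨f.lTensor M.V ∘ₗ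
      (TensorProduct.assoc ℂ M.V (tensorList L).V (tensorList L').V).toLinearMap,
      (Module.Flat.lTensor_preserves_injective_linearMap f hf).comp
        (TensorProduct.assoc ℂ M.V (tensorList L).V (tensorList L').V).injective, ?_⟩
    have h' := (h.lTensor M.family).comp (intertwines_assoc M.family (tensorList L).family
      (tensorList L').family)
    rw [← family_tensor, ← family_tensor M] at h'
    exact h'

/-- The tensor product of the modules in `L` has a nonzero highest vector of weight `g`. -/
def Realizes (L : List (YangianRep n)) (g : Fin n → LaurentSeries ℂ) : Prop :=
  ∃ a : Fin n → PowerSeries ℂ, (∀ i, (a i : LaurentSeries ℂ) = g i) ∧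
    ∃ x : (tensorList L).V, x ≠ 0 ∧ IsHighestFor (tensorList L).family x a

theorem realizes_nil : Realizes (n := n) [] fun _ => 1 :=
  ⟨fun _ => 1, fun _ => PowerSeries.coe_one, (1 : ℂ), one_ne_zero (α := ℂ),
    (family_triv (n := n)).symm ▸ isHighestFor_triv⟩

theorem Realizes.append {L L' : List (YangianRep n)} {g g' : Fin n → LaurentSeries ℂ}
    (h : Realizes L g) (h' : Realizes L' g') : Realizes (L ++ L') fun i => g i * g' i := by
  obtain ⟨a, ha, x, hx, hxa⟩ := h
  obtain ⟨a', ha', x', hx', hxa'⟩ := h'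
  obtain ⟨f, hf, hi⟩ := exists_intertwiner_append L L'
  refine ⟨fun i => a i * a' i, fun i => by rw [PowerSeries.coe_mul, ha, ha'],
    f (x ⊗ₜ[ℂ] x'), ?_, hi.isHighestFor (hxa.tmul hxa')⟩
  rw [Ne, map_eq_zero_iff f hf]
  exact tmul_ne_zero hx hx'

end YangianRep

/-! ### Exterior powers: creation and annihilation operators. -/

namespace YangianRep

open Yangian

variable {n : ℕ}

/-- Left multiplication by `e_i` in the exterior algebra of `ℂⁿ`. -/
noncomputable def create (i : Fin n) : Module.End ℂ (ExteriorAlgebra ℂ (Fin n → ℂ)) :=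
  LinearMap.mulLeft ℂ (ExteriorAlgebra.ι ℂ (Pi.single i 1))

/-- Contraction with the `i`-th coordinate in the exterior algebra of `ℂⁿ`. -/
noncomputable def annihilate (i : Fin n) : Module.End ℂ (ExteriorAlgebra ℂ (Fin n → ℂ)) :=
  CliffordAlgebra.contractLeft (LinearMap.proj i)

theorem create_create (i j : Fin n) (w) : create i (create j w) = -create j (create i w) := by
  simp only [create, LinearMap.mulLeft_apply, ← mul_assoc]
  rw [eq_neg_iff_add_eq_zero, ← add_mul, ExteriorAlgebra.ι_add_mul_swap, zero_mul]

theorem create_self (i : Fin n) (w) : create i (create i w) = 0 := by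
  simp [create, ← mul_assoc]

theorem annihilate_annihilate (i j : Fin n) (w) :
    annihilate i (annihilate j w) = -annihilate j (annihilate i w) :=
  CliffordAlgebra.contractLeft_comm _ _ _

theorem annihilate_create (i j : Fin n) (w) :
    annihilate i (create j w) = (if i = j then w else 0) - create j (annihilate i w) := by
  refine (CliffordAlgebra.contractLeft_ι_mul _ _ _).trans ?_
  simp only [LinearMap.proj_apply, Pi.single_apply, ite_smul, one_smul, zero_smul]
  rfl

theorem algebraMapInv_create (i : Fin n) (w) :
    ExteriorAlgebra.algebraMapInv (create i w) = 0 := by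
  simp [create, ExteriorAlgebra.algebraMapInv]

/-- The product `e_{k-1} ∧ ⋯ ∧ e_0`. -/
noncomputable def basicForm : (k : ℕ) → k ≤ n → ExteriorAlgebra ℂ (Fin n → ℂ)
  | 0, _ => 1
  | k + 1, h => create ⟨k, h⟩ (basicForm k (Nat.le_of_succ_le h))

theorem create_basicForm {k : ℕ} (h : k ≤ n) {i : Fin n} (hi : i.1 < k) :
    create i (basicForm k h) = 0 := by
  induction k with
  | zero => omega
  | succ k ih =>
    rw [basicForm]
    rcases Nat.lt_succ_iff_lt_or_eq.1 hi with hi | rfl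
    · rw [create_create, ih _ hi, map_zero, neg_zero]
    · exact create_self _ _

theorem annihilate_basicForm {k : ℕ} (h : k ≤ n) {i : Fin n} (hi : k ≤ i.1) :
    annihilate i (basicForm k h) = 0 := by
  induction k with
  | zero => exact CliffordAlgebra.contractLeft_one (Q := 0) _
  | succ k ih =>
    rw [basicForm, annihilate_create, ih _ (by omega), map_zero, sub_zero, if_neg]
    rintro rfl
    simp at hi

/-- For `i ≤ j < k` the creation by `e_i` kills the form, so the anticommutator leaves `δ_{ij}`; for
`j ≥ k` the contraction already vanishes. The condition `i ≤ j` covers exactly the upper triangular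
and diagonal generators. -/
theorem create_annihilate_basicForm {k : ℕ} (h : k ≤ n) (i j : Fin n) (hij : i ≤ j) :
    create i (annihilate j (basicForm k h))
      = if i = j ∧ i.1 < k then basicForm k h else 0 := by
  rcases lt_or_ge j.1 k with hj | hj
  · have hi : i.1 < k := lt_of_le_of_lt hij hj
    have := annihilate_create j i (basicForm k h)
    rw [create_basicForm h hi, map_zero, eq_comm, sub_eq_zero] at this
    rw [← this]
    simp [hi, eq_comm]
  · rw [annihilate_basicForm h hj, map_zero, if_neg]
    rintro ⟨rfl, hi⟩
    omega

/-- On the top form no order of `i` and `j` is required. Covector modules need this, because there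
`T_{ij}` acts with the indices interchanged. -/
theorem create_annihilate_top (i j : Fin n) : create i (annihilate j (basicForm n le_rfl))
    = if i = j then basicForm n le_rfl else 0 := by
  have := annihilate_create j i (basicForm n le_rfl)
  rw [create_basicForm _ i.2, map_zero, eq_comm, sub_eq_zero] at this
  rw [← this]
  simp [eq_comm]

theorem sum_create_annihilate_basicForm {k : ℕ} (h : k ≤ n) :
    ∑ a, create a (annihilate a (basicForm k h)) = (k : ℂ) • basicForm k h := by
  simp only [create_annihilate_basicForm h _ _ le_rfl, true_and]
  rw [← Finset.sum_filter, Finset.sum_const, ← Nat.cast_smul_eq_nsmul ℂ]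
  congr 2
  rw [Fin.card_filter_val_lt, min_eq_right h]

/-- The string `z + k - 1, …, z + 1, z`. -/
def chain (z : ℂ) : ℕ → List ℂ
  | 0 => []
  | k + 1 => (z + k) :: chain z k

/-- A family of representations on `ℂⁿ`. -/
def ofRep (ρ : ℂ → Yangian n →ₐ[ℂ] Module.End ℂ (Fin n → ℂ)) (z : ℂ) : YangianRep n where
  V := Fin n → ℂ
  ρ := ρ z

/-- The embedding of exterior powers of `ℂⁿ` into tensor powers. -/
noncomputable def antisymmetrize (ρ : ℂ → Yangian n →ₐ[ℂ] Module.End ℂ (Fin n → ℂ)) :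
    (l : List ℂ) → ExteriorAlgebra ℂ (Fin n → ℂ) →ₗ[ℂ] (tensorList (l.map (ofRep ρ))).V
  | [] => (ExteriorAlgebra.algebraMapInv (R := ℂ) (M := Fin n → ℂ)).toLinearMap
  | _ :: l => ∑ a, TensorProduct.mk ℂ (Fin n → ℂ) (tensorList (l.map (ofRep ρ))).V
      (Pi.single a 1) ∘ₗ antisymmetrize ρ l ∘ₗ annihilate a

theorem antisymmetrize_cons (ρ : ℂ → Yangian n →ₐ[ℂ] Module.End ℂ (Fin n → ℂ)) (z : ℂ)
    (l : List ℂ) (w) : antisymmetrize ρ (z :: l) w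
      = (∑ a, (Pi.single a 1 : Fin n → ℂ) ⊗ₜ[ℂ] antisymmetrize ρ l (annihilate a w) :
        (Fin n → ℂ) ⊗[ℂ] (tensorList (l.map (ofRep ρ))).V) := by
  refine (LinearMap.sum_apply _ _ _).trans ?_
  rfl

/-- Pairing the first tensor factor with the coordinate `k` strips `e_k` from the form and leaves
the image of the shorter one. -/
theorem antisymmetrize_basicForm_ne_zero (ρ : ℂ → Yangian n →ₐ[ℂ] Module.End ℂ (Fin n → ℂ)) (z : ℂ)
    {k : ℕ} (h : k ≤ n) : antisymmetrize ρ (chain z k) (basicForm k h) ≠ 0 := by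
  induction k with
  | zero =>
    change ExteriorAlgebra.algebraMapInv (1 : ExteriorAlgebra ℂ (Fin n → ℂ)) ≠ 0
    simp
  | succ k ih =>
    have hk := Nat.le_of_succ_le h
    intro h0
    apply ih hk
    have := congrArg (fun x => TensorProduct.lid ℂ _ (LinearMap.rTensor _
      (LinearMap.proj (⟨k, h⟩ : Fin n) : (Fin n → ℂ) →ₗ[ℂ] ℂ) x))
      ((antisymmetrize_cons ρ (z + k) (chain z k) (basicForm (k + 1) h)).symm.trans h0)
    simp only [map_sum, LinearMap.rTensor_tmul, LinearMap.proj_apply, TensorProduct.lid_tmul,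
      Pi.single_apply, ite_smul, one_smul, zero_smul, Finset.sum_ite_eq, Finset.mem_univ,
      if_true] at this
    rw [basicForm, annihilate_create, if_pos rfl, annihilate_basicForm hk le_rfl, map_zero,
      sub_zero] at this
    exact this.trans (by erw [map_zero])

end YangianRep

/-! ### Fusion: exterior powers inside tensor products with parameters in a string. -/

namespace YangianRep

open Yangian Finset.HasAntidiagonal

variable {n : ℕ}

theorem E_single (i j a : Fin n) : E i j (Pi.single a 1) = if j = a then Pi.single i 1 else 0 := by
  rw [E, Matrix.toLin'_apply, Matrix.mulVec_single_one]
  ext b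
  by_cases h : j = a <;> simp [h, Matrix.single_apply, Pi.single_apply, eq_comm]

section

variable {W : Type*} [AddCommGroup W] [Module ℂ W]

theorem tensorFamily_evalFamily_succ (z : ℂ) (B : Fin n → Fin n → Module.End ℂ (Fin n → ℂ))
    (t : Fin n → Fin n → ℕ → Module.End ℂ W) (i j : Fin n) (r : ℕ) (e : Fin n → ℂ) (x : W) :
    tensorFamily (evalFamily z B) t i j (r + 1) (e ⊗ₜ x) = e ⊗ₜ t i j (r + 1) x
      + ∑ l, B i l e ⊗ₜ[ℂ] ∑ p ∈ antidiagonal r, z ^ p.1 • t l j p.2 x := by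
  have h : ∀ k, ∑ p ∈ antidiagonal (r + 1), evalFamily z B i k p.1 e ⊗ₜ[ℂ] t k j p.2 x
      = (if i = k then e ⊗ₜ t i j (r + 1) x else 0)
        + B i k e ⊗ₜ[ℂ] ∑ p ∈ antidiagonal r, z ^ p.1 • t k j p.2 x := by
    intro k
    rw [Finset.Nat.sum_antidiagonal_succ, TensorProduct.tmul_sum]
    congr 1
    · simp only [evalFamily]
      split_ifs with h
      · simp [h]
      · simp
    · simp [evalFamily, TensorProduct.smul_tmul]
  rw [tensorFamily_tmul, Finset.sum_congr rfl fun k _ => h k, Finset.sum_add_distrib]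
  simp

/-- In generating series: `(X + (z - y) X / (u - z)) / (u - y) = X / (u - z)`. The pole at `y`
cancels. -/
theorem sum_antidiagonal_of_rec {y z : ℂ} {F : ℕ → W} {X Y : W} (h0 : F 0 = X)
    (hs : ∀ q, F (q + 1) = z ^ q • Y) (r : ℕ) (hXY : Y = (z - y) • X) :
    ∑ p ∈ antidiagonal r, y ^ p.1 • F p.2 = z ^ r • X := by
  induction r with
  | zero => simp [h0]
  | succ r ih =>
    rw [Finset.Nat.sum_antidiagonal_succ, pow_zero, one_smul, hs]
    simp only [pow_succ', mul_smul]
    rw [← Finset.smul_sum, ih, hXY]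
    module

/-- `∑ₐ create a ∘ annihilate a` is the degree operator of the exterior algebra, and contraction
lowers degree by one. Homogeneity is expressed through this eigenvalue equation. -/
theorem degree_annihilate {k : ℕ} {w : ExteriorAlgebra ℂ (Fin n → ℂ)}
    (hw : ∑ a, create a (annihilate a w) = ((k + 1 : ℕ) : ℂ) • w) (b : Fin n) :
    ∑ a, create a (annihilate a (annihilate b w)) = (k : ℂ) • annihilate b w := by
  have h : ∀ a, create a (annihilate a (annihilate b w))
      = annihilate b (create a (annihilate a w)) - if b = a then annihilate b w else 0 := by
    intro a
    rw [annihilate_annihilate a b, annihilate_create]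
    split_ifs with h
    · simp [h]
    · simp
  rw [Finset.sum_congr rfl fun a _ => h a, Finset.sum_sub_distrib, ← map_sum, hw]
  simp only [Finset.sum_ite_eq, Finset.mem_univ, if_true, map_smul]
  push_cast
  module

/-- Inductive step: if `T_{ij}(u)` acts on the image of `Λᵏ` as `δ_{ij} + create i ∘ annihilate j /
(u - z)`, then it does so on `Λᵏ⁺¹` after a vector module with parameter `z + k` is placed in front.
The shift by `k` is what makes the second pole cancel. -/
theorem fusion_vector {t : Fin n → Fin n → ℕ → Module.End ℂ W}
    {C : ExteriorAlgebra ℂ (Fin n → ℂ) →ₗ[ℂ] W} {k : ℕ} {z : ℂ}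
    (h0 : ∀ i j, t i j 0 = if i = j then 1 else 0)
    (hC : ∀ w, ∑ a, create a (annihilate a w) = (k : ℂ) • w → ∀ i j r,
      t i j (r + 1) (C w) = z ^ r • C (create i (annihilate j w)))
    (w : ExteriorAlgebra ℂ (Fin n → ℂ))
    (hw : ∑ a, create a (annihilate a w) = ((k + 1 : ℕ) : ℂ) • w) (i j : Fin n) (r : ℕ) :
    tensorFamily (evalFamily (z + k) fun i j => E i j) t i j (r + 1)
        (∑ a, (Pi.single a 1 : Fin n → ℂ) ⊗ₜ[ℂ] C (annihilate a w))
      = z ^ r • ∑ a, (Pi.single a 1 : Fin n → ℂ) ⊗ₜ[ℂ]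
          C (annihilate a (create i (annihilate j w))) := by
  -- The degree of `annihilate j w` is `k`, and interchanging two contractions gives a sign, so the
  -- residue is `-k = z - (z + k)` times the leading term.
  have hF : ∑ p ∈ antidiagonal r, (z + k) ^ p.1 • (∑ a, t a j p.2 (C (annihilate a w)))
      = z ^ r • C (annihilate j w) := by
    refine sum_antidiagonal_of_rec (F := fun q => ∑ a, t a j q (C (annihilate a w))) ?_
      (fun q => ?_) r rfl
    · simp only [h0]
      rw [Finset.sum_eq_single j]
      · simp
      · intro a _ ha; simp [ha]
      · simp
    · simp only [hC _ (degree_annihilate hw _)]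
      rw [← Finset.smul_sum, ← map_sum]
      congr 1
      have := degree_annihilate hw j
      simp only [annihilate_annihilate j, map_neg, Finset.sum_neg_distrib, this]
      simp
  simp only [map_sum, tensorFamily_evalFamily_succ, E_single, hC _ (degree_annihilate hw _),
    annihilate_create]
  rw [Finset.sum_add_distrib]
  have h2 : ∑ a, ∑ l, (if l = a then (Pi.single i 1 : Fin n → ℂ) else 0) ⊗ₜ[ℂ]
      ∑ p ∈ antidiagonal r, (z + k) ^ p.1 • t l j p.2 (C (annihilate a w))
      = (Pi.single i 1 : Fin n → ℂ) ⊗ₜ[ℂ] (z ^ r • C (annihilate j w)) := by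
    rw [← hF]
    simp only [TensorProduct.ite_tmul, Finset.sum_ite_eq',
      Finset.mem_univ, if_true]
    rw [← TensorProduct.tmul_sum, Finset.sum_comm]
    simp only [Finset.smul_sum]
  rw [h2]
  simp only [map_sub, TensorProduct.tmul_sub, Finset.sum_sub_distrib, smul_sub,
    TensorProduct.tmul_smul, Finset.smul_sum]
  have h3 : ∀ a, annihilate j (annihilate a w) = -annihilate a (annihilate j w) :=
    fun a => annihilate_annihilate _ _ _
  have h4 : ∑ a, z ^ r • (Pi.single a 1 : Fin n → ℂ) ⊗ₜ[ℂ]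
      C (if a = i then annihilate j w else 0) =
      z ^ r • (Pi.single i 1 : Fin n → ℂ) ⊗ₜ[ℂ] C (annihilate j w) := by
    rw [Finset.sum_eq_single i]
    · simp
    · intro a _ ha; simp [ha]
    · simp
  rw [h4]
  simp only [h3, map_neg, TensorProduct.tmul_neg, smul_neg, Finset.sum_neg_distrib]
  abel

/-- For covectors the surviving pole is that of the new first factor, `y + 1`, and the old pole `y`
cancels. The cancellation does not involve the degree of `w`. -/
theorem fusion_covector {t : Fin n → Fin n → ℕ → Module.End ℂ W}
    {C : ExteriorAlgebra ℂ (Fin n → ℂ) →ₗ[ℂ] W} {y : ℂ}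
    (h0 : ∀ i j, t i j 0 = if i = j then 1 else 0)
    (hC : ∀ w i j r, t i j (r + 1) (C w) = y ^ r • C (-create j (annihilate i w)))
    (w : ExteriorAlgebra ℂ (Fin n → ℂ)) (i j : Fin n) (r : ℕ) :
    tensorFamily (evalFamily (y + 1) fun i j => -E j i) t i j (r + 1)
        (∑ a, (Pi.single a 1 : Fin n → ℂ) ⊗ₜ[ℂ] C (annihilate a w))
      = (y + 1) ^ r • ∑ a, (Pi.single a 1 : Fin n → ℂ) ⊗ₜ[ℂ]
          C (annihilate a (-create j (annihilate i w))) := by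
  set X : (Fin n → ℂ) ⊗[ℂ] W := (Pi.single j 1 : Fin n → ℂ) ⊗ₜ[ℂ] C (annihilate i w)
  set Y : (Fin n → ℂ) ⊗[ℂ] W := ∑ a, (Pi.single a 1 : Fin n → ℂ) ⊗ₜ[ℂ]
    C (create j (annihilate a (annihilate i w)))
  -- This is the partial fraction `1/((u-y-1)(u-y)) = 1/(u-y-1) - 1/(u-y)`; the spacing `1` of the
  -- poles makes the numerators `±1`.
  have hF : ∑ p ∈ antidiagonal r, (y + 1) ^ p.1 •
      (∑ l, (Pi.single l 1 : Fin n → ℂ) ⊗ₜ[ℂ] t l j p.2 (C (annihilate i w)))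
      = (y + 1) ^ r • X - ((y + 1) ^ r - y ^ r) • Y := by
    induction r with
    | zero =>
      simp only [antidiagonal_zero, Finset.sum_singleton, h0]
      rw [Finset.sum_eq_single j]
      · simp [X]
      · intro a _ ha; simp [ha]
      · simp
    | succ r ih =>
      rw [Finset.Nat.sum_antidiagonal_succ, pow_zero, one_smul]
      simp only [pow_succ' _ (_ : ℕ), mul_smul]
      rw [← Finset.smul_sum, ih]
      simp only [hC, map_neg, TensorProduct.tmul_neg, smul_neg, TensorProduct.tmul_smul,
        Finset.sum_neg_distrib]
      rw [← Finset.smul_sum]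
      module
  simp only [map_sum, tensorFamily_evalFamily_succ, LinearMap.neg_apply, E_single, hC,
    annihilate_create, map_neg]
  rw [Finset.sum_add_distrib]
  have h2 : ∑ a, ∑ l, (-(if i = a then (Pi.single l 1 : Fin n → ℂ) else 0)) ⊗ₜ[ℂ]
      ∑ p ∈ antidiagonal r, (y + 1) ^ p.1 • t l j p.2 (C (annihilate a w))
      = -((y + 1) ^ r • X - ((y + 1) ^ r - y ^ r) • Y) := by
    rw [← hF, Finset.sum_eq_single i]
    · simp only [if_true, TensorProduct.neg_tmul, TensorProduct.tmul_sum, TensorProduct.tmul_smul,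
        Finset.smul_sum]
      rw [Finset.sum_comm]
      simp only [smul_neg, Finset.sum_neg_distrib]
    · intro a _ ha; simp [ha.symm]
    · simp
  rw [h2]
  have h3 : ∀ a, annihilate i (annihilate a w) = -annihilate a (annihilate i w) :=
    fun a => annihilate_annihilate _ _ _
  have h4 : ∑ a, (Pi.single a 1 : Fin n → ℂ) ⊗ₜ[ℂ] C (if a = j then annihilate i w else 0) = X := by
    rw [Finset.sum_eq_single j]
    · simp [X]
    · intro a _ ha; simp [ha]
    · simp
  simp only [h3, map_neg, neg_neg, map_sub, TensorProduct.tmul_sub, TensorProduct.tmul_smul,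
    TensorProduct.tmul_neg, Finset.sum_neg_distrib, Finset.sum_sub_distrib]
  rw [← Finset.smul_sum, h4]
  change y ^ r • Y + _ = (y + 1) ^ r • -(X - Y)
  module

end

end YangianRep

/-! ### Highest weights realized by vector and covector modules. -/

namespace YangianRep

open Yangian

variable {n : ℕ}

theorem family_zero (M : YangianRep n) (i j : Fin n) :
    M.family i j 0 = if i = j then 1 else 0 := by
  rw [family, T_zero]
  split_ifs <;> simp

/-- The action of the Yangian on a vector module. -/
noncomputable def vectorRep (z : ℂ) : Yangian n →ₐ[ℂ] Module.End ℂ (Fin n → ℂ) :=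
  Yangian.lift (evalFamily z fun i j => E i j) (isYangianFamily_vector n z)

/-- The action of the Yangian on a covector module. -/
noncomputable def covectorRep (z : ℂ) : Yangian n →ₐ[ℂ] Module.End ℂ (Fin n → ℂ) :=
  Yangian.lift (evalFamily (z - 1) fun i j => -E j i) (isYangianFamily_covector n z)

theorem family_vector (z : ℂ) : (vector n z).family = evalFamily z fun i j => E i j := by
  funext i j r
  exact lift_T _ (isYangianFamily_vector n z) i j r

theorem family_covector (z : ℂ) :
    (covector n z).family = evalFamily (z - 1) fun i j => -E j i := by
  funext i j r
  exact lift_T _ (isYangianFamily_covector n z) i j r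

theorem family_tensor_vector (z : ℂ) (N : YangianRep n) :
    (tensor (vector n z) N).family = tensorFamily (evalFamily z fun i j => E i j) N.family :=
  (family_tensor _ _).trans (congrArg (fun s : Fin n → Fin n → ℕ → Module.End ℂ (Fin n → ℂ) =>
    tensorFamily s N.family) (family_vector z))

theorem family_tensor_covector (z : ℂ) (N : YangianRep n) :
    (tensor (covector n z) N).family
      = tensorFamily (evalFamily (z - 1) fun i j => -E j i) N.family :=
  (family_tensor _ _).trans (congrArg (fun s : Fin n → Fin n → ℕ → Module.End ℂ (Fin n → ℂ) =>
    tensorFamily s N.family) (family_covector z))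

theorem family_antisymmetrize_vector (z : ℂ) (k : ℕ) : ∀ w : ExteriorAlgebra ℂ (Fin n → ℂ),
    ∑ a, create a (annihilate a w) = (k : ℂ) • w → ∀ i j r,
      (tensorList ((chain z k).map (ofRep vectorRep))).family i j (r + 1)
        (antisymmetrize vectorRep (chain z k) w)
      = z ^ r • antisymmetrize vectorRep (chain z k) (create i (annihilate j w)) := by
  induction k with
  | zero =>
    intro w _ i j r
    have h₁ : (triv n).family i j (r + 1) = 0 := by rw [family_triv]; rfl
    have h₂ : antisymmetrize vectorRep (chain z 0) (create i (annihilate j w)) = 0 :=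
      algebraMapInv_create _ _
    rw [h₂, smul_zero]
    exact LinearMap.congr_fun h₁ _
  | succ k ih =>
    intro w hw i j r
    have h := fusion_vector (family_zero _) ih w hw i j r
    rw [← family_tensor_vector] at h
    rw [chain, antisymmetrize_cons, antisymmetrize_cons]
    exact h

/-- The first of the parameters is `z + k - 1`, and a covector module has its pole one below its
parameter. For `k = 0` the value `z - 2` is immaterial, as both sides vanish. -/
theorem family_antisymmetrize_covector (z : ℂ) (k : ℕ) (w : ExteriorAlgebra ℂ (Fin n → ℂ))
    (i j : Fin n) (r : ℕ) :
      (tensorList ((chain z k).map (ofRep covectorRep))).family i j (r + 1)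
        (antisymmetrize covectorRep (chain z k) w)
      = (z + k - 2) ^ r •
        antisymmetrize covectorRep (chain z k) (-create j (annihilate i w)) := by
  induction k generalizing w i j r with
  | zero =>
    have h₁ : (triv n).family i j (r + 1) = 0 := by rw [family_triv]; rfl
    have h₂ : antisymmetrize covectorRep (chain z 0) (create j (annihilate i w)) = 0 :=
      algebraMapInv_create _ _
    rw [map_neg, h₂, neg_zero, smul_zero]
    exact LinearMap.congr_fun h₁ _
  | succ k ih =>
    have h := fusion_covector (family_zero _) ih w i j r
    rw [show z + k - 2 + 1 = z + k - 1 by ring, ← family_tensor_covector] at h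
    rw [chain, antisymmetrize_cons, antisymmetrize_cons,
      show z + ((k + 1 : ℕ) : ℂ) - 2 = z + k - 1 by push_cast; ring]
    exact h

theorem coeff_zero_evalSeries (y c : ℂ) : PowerSeries.coeff 0 (evalSeries y c) = 1 := by
  simp [evalSeries]

theorem coeff_succ_evalSeries (y c : ℂ) (r : ℕ) :
    PowerSeries.coeff (r + 1) (evalSeries y c) = y ^ r * c := by
  simp [evalSeries]

/-- The highest vector is the image of `e_{k-1} ∧ ⋯ ∧ e_0`: this is a fundamental module, and `k =
n` gives the quantum determinant factor. -/
theorem realizes_vector (z : ℂ) {k : ℕ} (hk : k ≤ n) :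
    Realizes ((chain z k).map (vector n))
      fun i => if i.1 < k then (evalSeries z 1 : LaurentSeries ℂ) else 1 := by
  change Realizes ((chain z k).map (ofRep vectorRep)) _
  refine ⟨fun i => if i.1 < k then evalSeries z 1 else 1, fun i => ?_,
    antisymmetrize vectorRep (chain z k) (basicForm k hk),
    antisymmetrize_basicForm_ne_zero _ _ hk, ?_, ?_⟩
  · dsimp only
    split_ifs <;> simp
  · intro i j hij r
    cases r with
    | zero => rw [family_zero, if_neg hij.ne, LinearMap.zero_apply]
    | succ r =>
      rw [family_antisymmetrize_vector z k _ (sum_create_annihilate_basicForm hk),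
        create_annihilate_basicForm hk _ _ hij.le, if_neg fun h => hij.ne h.1, map_zero, smul_zero]
  · intro i r
    cases r with
    | zero =>
      rw [family_zero, if_pos rfl, Module.End.one_apply]
      split_ifs <;> simp [coeff_zero_evalSeries]
    | succ r =>
      rw [family_antisymmetrize_vector z k _ (sum_create_annihilate_basicForm hk),
        create_annihilate_basicForm hk _ _ le_rfl]
      by_cases h : i.1 < k
      · rw [if_pos ⟨rfl, h⟩, if_pos h, coeff_succ_evalSeries, mul_one]
      · rw [if_neg fun h' => h h'.2, if_neg h, map_zero, smul_zero]
        simp [PowerSeries.coeff_one]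

theorem realizes_covector (z : ℂ) :
    Realizes ((chain z n).map (covector n))
      fun _ => (evalSeries (z + n - 2) (-1) : LaurentSeries ℂ) := by
  change Realizes ((chain z n).map (ofRep covectorRep)) _
  refine ⟨fun _ => evalSeries (z + n - 2) (-1), fun i => rfl,
    antisymmetrize covectorRep (chain z n) (basicForm n le_rfl),
    antisymmetrize_basicForm_ne_zero _ _ le_rfl, ?_, ?_⟩
  · intro i j hij r
    cases r with
    | zero => rw [family_zero, if_neg hij.ne, LinearMap.zero_apply]
    | succ r =>
      rw [family_antisymmetrize_covector, create_annihilate_top, if_neg hij.ne', neg_zero,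
        map_zero, smul_zero]
  · intro i r
    cases r with
    | zero =>
      rw [family_zero, if_pos rfl, Module.End.one_apply, coeff_zero_evalSeries, one_smul]
    | succ r =>
      rw [family_antisymmetrize_covector, create_annihilate_top, if_pos rfl, map_neg,
        coeff_succ_evalSeries, smul_neg, mul_neg_one, neg_smul]

/-- The weight by which all the diagonal series up to the `k`-th are multiplied by `f`. -/
noncomputable def stepWeight (n k : ℕ) (f : LaurentSeries ℂ) (i : Fin n) : LaurentSeries ℂ :=
  if i.1 < k then f else 1

theorem exists_realizes_step {k : ℕ} (hk : k ≤ n) {P : Polynomial ℂ} (hP : P ≠ 0) :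
    ∃ l : List ℂ, Realizes (l.map (vector n)) (stepWeight n k (shiftRatio P)) := by
  rw [shiftRatio_eq_prod_roots hP]
  induction P.roots using Multiset.induction with
  | empty =>
    have h : stepWeight n k 1 = fun _ => 1 := by funext i; simp [stepWeight]
    exact ⟨[], by simpa [h] using realizes_nil⟩
  | cons z s ih =>
    obtain ⟨l, hl⟩ := ih
    refine ⟨chain z k ++ l, ?_⟩
    rw [List.map_append]
    convert (realizes_vector z hk).append hl using 2 with i
    simp only [stepWeight, Multiset.map_cons, Multiset.prod_cons]
    split_ifs <;> simp

theorem exists_realizes_inv {P : Polynomial ℂ} (hP : P ≠ 0) :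
    ∃ l : List ℂ, Realizes (l.map (covector n)) fun _ => (shiftRatio P)⁻¹ := by
  rw [shiftRatio_eq_prod_roots hP]
  induction P.roots using Multiset.induction with
  | empty => exact ⟨[], by simpa using realizes_nil⟩
  | cons z s ih =>
    obtain ⟨l, hl⟩ := ih
    -- This start of the string puts the pole `z + 1 - n + n - 2` at `z - 1`, where the inverse of
    -- the factor of the root `z` has its pole.
    refine ⟨chain (z + 1 - n) n ++ l, ?_⟩
    rw [List.map_append]
    convert (realizes_covector (z + 1 - n)).append hl using 2 with i
    rw [Multiset.map_cons, Multiset.prod_cons, mul_inv, ← shiftRatio_X_sub_C,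
      shiftRatio_X_sub_C_inv, show z + 1 - n + n - 2 = z - 1 by ring]

end YangianRep

/-! ### Eigenvalues of `T_{nn}(u)` on subquotients of tensor products. -/

namespace Yangian

open YangianRep Finset.HasAntidiagonal

section

variable {W N : Type*} [AddCommGroup W] [Module ℂ W] [AddCommGroup N] [Module ℂ N]

/-- The operators `t r` have a common eigenvector with eigenvalues the coefficients of `A` in the
quotient of `W` by an invariant subspace. -/
def HasQuotientEigenvalue (t : ℕ → Module.End ℂ W) (A : PowerSeries ℂ) : Prop :=
  ∃ K : Submodule ℂ W, (∀ r, ∀ x ∈ K, t r x ∈ K) ∧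
    ∃ v, v ∉ K ∧ ∀ r, t r v - PowerSeries.coeff r A • v ∈ K

theorem mem_of_eq_zero {F : Submodule ℂ W} {x : W} (h : x = 0) : x ∈ F := h ▸ F.zero_mem

theorem hasQuotientEigenvalue_of_mem_sup_range {t : ℕ → Module.End ℂ W} {s : ℕ → Module.End ℂ N}
    {e : N →ₗ[ℂ] W} {F : Submodule ℂ W} (hF : ∀ r, ∀ x ∈ F, t r x ∈ F)
    (ht : ∀ r x, t r (e x) - e (s r x) ∈ F) {A : PowerSeries ℂ} {v : W} (hv : v ∉ F)
    (hve : v ∈ F ⊔ LinearMap.range e) (htv : ∀ r, t r v - PowerSeries.coeff r A • v ∈ F) :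
    HasQuotientEigenvalue s A := by
  obtain ⟨y, hy, _, ⟨x, rfl⟩, rfl⟩ := Submodule.mem_sup.1 hve
  refine ⟨F.comap e, fun r x' hx' => ?_, x, fun hx => hv (add_mem hy hx), fun r => ?_⟩
  · have := sub_mem (hF r _ hx') (ht r x')
    rwa [sub_sub_cancel] at this
  · have := sub_mem (sub_mem (htv r) (ht r x))
      (sub_mem (hF r y hy) (Submodule.smul_mem _ (PowerSeries.coeff r A) hy))
    rw [Submodule.mem_comap, map_sub, map_smul]
    convert this using 1
    rw [map_add, smul_add]
    abel

/-- The sum of the ranges of the maps with labels below `k`. -/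
def rangeBelow {ι : Type*} (κ : ι → ℕ) (e : ι → N →ₗ[ℂ] W) (k : ℕ) : Submodule ℂ W :=
  ⨆ b, ⨆ _ : κ b < k, LinearMap.range (e b)

theorem mem_rangeBelow {ι : Type*} {κ : ι → ℕ} {e : ι → N →ₗ[ℂ] W} {k : ℕ} {b : ι} (hb : κ b < k)
    (x : N) : e b x ∈ rangeBelow κ e k :=
  Submodule.mem_iSup_of_mem b (Submodule.mem_iSup_of_mem hb ⟨x, rfl⟩)

theorem rangeBelow_le {ι : Type*} {κ : ι → ℕ} {e : ι → N →ₗ[ℂ] W} {k : ℕ} {F : Submodule ℂ W}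
    (h : ∀ b, κ b < k → ∀ x, e b x ∈ F) : rangeBelow κ e k ≤ F := by
  refine iSup₂_le ?_
  rintro b hb _ ⟨x, rfl⟩
  exact h b hb x

/-- An eigenvector in a quotient of a filtered space appears in the first step that contains it
modulo `K`, hence yields one in a quotient of that graded piece. The maps `e a` identify the pieces
with quotients of one space `N`, on which `s a` acts. -/
theorem HasQuotientEigenvalue.of_filtration {ι : Type*} [Finite ι] {κ : ι → ℕ}
    (hκ : Function.Injective κ) {t : ℕ → Module.End ℂ W} {s : ι → ℕ → Module.End ℂ N}
    {e : ι → N →ₗ[ℂ] W} (htop : ⨆ a, LinearMap.range (e a) = ⊤)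
    (ht : ∀ a r x, t r (e a x) - e a (s a r x) ∈ rangeBelow κ e (κ a))
    {A : PowerSeries ℂ} (h : HasQuotientEigenvalue t A) : ∃ a, HasQuotientEigenvalue (s a) A := by
  obtain ⟨K, hK, v, hv, htv⟩ := h
  have hmono : ∀ {j k}, j ≤ k → rangeBelow κ e j ≤ rangeBelow κ e k := fun hjk =>
    rangeBelow_le fun b hb => mem_rangeBelow (hb.trans_le hjk)
  have hF : ∀ k r, ∀ x ∈ K ⊔ rangeBelow κ e k, t r x ∈ K ⊔ rangeBelow κ e k := by
    intro k r
    refine (sup_le (fun x hx => ?_) (rangeBelow_le fun b hb x => ?_) :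
      K ⊔ rangeBelow κ e k ≤ (K ⊔ rangeBelow κ e k).comap (t r))
    · exact Submodule.mem_sup_left (hK r x hx)
    · rw [Submodule.mem_comap, ← sub_add_cancel (t r (e b x)) (e b (s b r x))]
      exact Submodule.mem_sup_right (add_mem (hmono hb.le (ht b r x)) (mem_rangeBelow hb _))
  have key : ∀ k, v ∈ K ⊔ rangeBelow κ e k → ∃ a, HasQuotientEigenvalue (s a) A := by
    intro k
    induction k with
    | zero => exact fun h => absurd (by simpa [rangeBelow] using h) hv
    | succ k ih =>
      intro hvk
      by_cases hvk' : v ∈ K ⊔ rangeBelow κ e k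
      · exact ih hvk'
      obtain ⟨a, rfl⟩ : ∃ a, κ a = k := by
        by_contra! hne
        exact hvk' (sup_le_sup_left (rangeBelow_le fun b hb =>
          mem_rangeBelow (lt_of_le_of_ne (Nat.le_of_lt_succ hb) (hne b))) K hvk)
      refine ⟨a, hasQuotientEigenvalue_of_mem_sup_range (hF (κ a))
        (fun r x => Submodule.mem_sup_right (ht a r x)) hvk' ?_
        fun r => Submodule.mem_sup_left (htv r)⟩
      refine (sup_le (le_sup_left.trans le_sup_left) (rangeBelow_le fun b hb x => ?_) :
        K ⊔ rangeBelow κ e (κ a + 1) ≤ _) hvk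
      rcases Nat.lt_succ_iff_lt_or_eq.1 hb with hb | hb
      · exact Submodule.mem_sup_left (Submodule.mem_sup_right (mem_rangeBelow hb x))
      · rw [hκ hb]
        exact Submodule.mem_sup_right ⟨x, rfl⟩
  obtain ⟨M, hM⟩ := (Set.finite_range κ).bddAbove
  refine key (M + 1) (Submodule.mem_sup_right ?_)
  have : (⊤ : Submodule ℂ W) ≤ rangeBelow κ e (M + 1) := by
    rw [← htop]
    refine iSup_le fun b => ?_
    rintro _ ⟨x, rfl⟩
    exact mem_rangeBelow (Nat.lt_succ_of_le (hM ⟨b, rfl⟩)) x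
  exact this trivial

/-- A scalar series with nonzero constant term is invertible, so multiplying by it neither creates
nor loses invariant subspaces or eigenvectors. -/
theorem HasQuotientEigenvalue.of_mul {f : PowerSeries ℂ} (hf : PowerSeries.coeff 0 f ≠ 0)
    {t : ℕ → Module.End ℂ W} {A : PowerSeries ℂ}
    (h : HasQuotientEigenvalue
      (fun r => ∑ p ∈ antidiagonal r, PowerSeries.coeff p.1 f • t p.2) A) :
    ∃ A', HasQuotientEigenvalue t A' ∧ A = f * A' := by
  obtain ⟨K, hK, v, hv, htv⟩ := h
  have hgf : f⁻¹ * f = 1 := PowerSeries.inv_mul_cancel f (by simpa using hf)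
  set s : ℕ → Module.End ℂ W := fun r => ∑ p ∈ antidiagonal r, PowerSeries.coeff p.1 f • t p.2
  -- Comparison of coefficients in power series over `Module.End ℂ W`, where `s = f t` becomes `t =
  -- f⁻¹ s`.
  have ht : ∀ r, t r = ∑ p ∈ antidiagonal r, PowerSeries.coeff p.1 f⁻¹ • s p.2 := by
    intro r
    have hc : PowerSeries.mk t = PowerSeries.map (algebraMap ℂ (Module.End ℂ W)) f⁻¹ *
        (PowerSeries.map (algebraMap ℂ (Module.End ℂ W)) f * PowerSeries.mk t) := by
      rw [← mul_assoc, ← map_mul, hgf, map_one, one_mul]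
    have := congrArg (PowerSeries.coeff r) hc
    simpa only [PowerSeries.coeff_mul, PowerSeries.coeff_mk, PowerSeries.coeff_map,
      ← Algebra.smul_def] using this
  refine ⟨f⁻¹ * A, ⟨K, fun r x hx => ?_, v, hv, fun r => ?_⟩, ?_⟩
  · rw [ht, LinearMap.sum_apply]
    exact Submodule.sum_mem _ fun p _ => Submodule.smul_mem _ _ (hK _ _ hx)
  · rw [ht, LinearMap.sum_apply, PowerSeries.coeff_mul, Finset.sum_smul, ← Finset.sum_sub_distrib]
    refine Submodule.sum_mem _ fun p _ => ?_
    rw [LinearMap.smul_apply, mul_smul, ← smul_sub]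
    exact Submodule.smul_mem _ _ (htv _)
  · rw [← mul_assoc, mul_comm f, hgf, one_mul]

theorem HasQuotientEigenvalue.eq_of_scalar {A B : PowerSeries ℂ} {t : ℕ → Module.End ℂ W}
    (ht : ∀ r x, t r x = PowerSeries.coeff r B • x) (h : HasQuotientEigenvalue t A) : A = B := by
  obtain ⟨K, -, v, hv, htv⟩ := h
  ext r
  have := htv r
  rw [ht, ← sub_smul] at this
  by_contra hne
  exact hv ((Submodule.smul_mem_iff _ (sub_ne_zero.2 (Ne.symm hne))).1 this)

end

section

variable {n : ℕ} {N : Type*} [AddCommGroup N] [Module ℂ N]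

theorem tensorFamily_evalFamily_zero (z : ℂ) (B : Fin n → Fin n → Module.End ℂ (Fin n → ℂ))
    (t : Fin n → Fin n → ℕ → Module.End ℂ N) (i j : Fin n) (e : Fin n → ℂ) (x : N) :
    tensorFamily (evalFamily z B) t i j 0 (e ⊗ₜ x) = e ⊗ₜ t i j 0 x := by
  rw [tensorFamily_tmul, Finset.sum_eq_single i]
  · simp [evalFamily]
  · intro k _ hk; simp [evalFamily, hk.symm]
  · simp

theorem iSup_range_mk_single :
    ⨆ a, LinearMap.range (TensorProduct.mk ℂ (Fin n → ℂ) N (Pi.single a 1)) = ⊤ := by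
  rw [eq_top_iff]
  rintro x -
  induction x using TensorProduct.induction_on with
  | zero => exact zero_mem _
  | add x y hx hy => exact add_mem (hx) (hy)
  | tmul e x =>
    rw [pi_eq_sum_univ' e, TensorProduct.sum_tmul]
    refine Submodule.sum_mem _ fun a _ => Submodule.mem_iSup_of_mem a ⟨e a • x, ?_⟩
    rw [TensorProduct.mk_apply, TensorProduct.smul_tmul]

theorem evalSeries_conv_succ (y c : ℂ) (t : ℕ → Module.End ℂ N) (r : ℕ) :
    ∑ p ∈ antidiagonal (r + 1), PowerSeries.coeff p.1 (evalSeries y c) • t p.2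
      = t (r + 1) + c • ∑ p ∈ antidiagonal r, y ^ p.1 • t p.2 := by
  rw [Finset.Nat.sum_antidiagonal_succ, Finset.smul_sum]
  simp [evalSeries, smul_smul, mul_comm]

/-- With `m` the last index, `T_{mm}(u)(e_a ⊗ x) = e_a ⊗ T_{mm}(u) x + e_m ⊗ T_{am}(u) x / (u - z)`.
So `e_m ⊗ N` is invariant with the extra factor `1 + 1/(u - z)`, and the other pieces carry
`T_{mm}(u)` unchanged. -/
theorem HasQuotientEigenvalue.of_vector {z : ℂ} {t : Fin n → Fin n → ℕ → Module.End ℂ N} {m : Fin n}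
    (hm : ∀ a, a ≤ m) {A : PowerSeries ℂ}
    (h : HasQuotientEigenvalue (tensorFamily (evalFamily z fun i j => E i j) t m m) A) :
    ∃ A', HasQuotientEigenvalue (t m m) A' ∧ (A = A' ∨ A = evalSeries z 1 * A') := by
  -- The reversed order places `e_m` at the bottom of the filtration.
  have hκ : Function.Injective fun a : Fin n => n - a.1 := fun a b hab => by
    ext; dsimp only at hab; omega
  refine Exists.elim (h.of_filtration hκ iSup_range_mk_single
    (s := fun a => if a = m then
      fun r => ∑ p ∈ antidiagonal r, PowerSeries.coeff p.1 (evalSeries z 1) • t m m p.2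
      else t m m) ?_) fun a ha => ?_
  · intro a r x
    simp only [TensorProduct.mk_apply]
    cases r with
    | zero =>
      rw [tensorFamily_evalFamily_zero]
      refine mem_of_eq_zero ?_
      split_ifs <;> simp [evalSeries]
    | succ r =>
      rw [tensorFamily_evalFamily_succ]
      simp only [E_single, TensorProduct.ite_tmul, Finset.sum_ite_eq', Finset.mem_univ, if_true]
      split_ifs with h
      · subst h
        beta_reduce
        rw [evalSeries_conv_succ, one_smul]
        refine mem_of_eq_zero ?_
        simp [LinearMap.sum_apply, TensorProduct.tmul_add]
      · rw [add_sub_cancel_left]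
        refine mem_rangeBelow (e := fun a => TensorProduct.mk ℂ (Fin n → ℂ) N (Pi.single a 1)) ?_ _
        have := lt_of_le_of_ne (hm a) h
        have := m.2
        have : a.1 < m.1 := by assumption
        omega
  · split_ifs at ha with h
    · obtain ⟨A', h₁, h₂⟩ := ha.of_mul (by simp [evalSeries])
      exact ⟨A', h₁, Or.inr h₂⟩
    · exact ⟨A, ha, Or.inl rfl⟩

/-- Here `e_a ⊗ N` is invariant for `a ≠ m`, while `e_m ⊗ x` is sent to `e_m ⊗ T_{mm}(u) x - ∑ₖ e_k
⊗ T_{km}(u) x / (u - y)`. Hence `e_m` comes last, in the natural order of the indices. -/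
theorem HasQuotientEigenvalue.of_covector {y : ℂ} {t : Fin n → Fin n → ℕ → Module.End ℂ N}
    {m : Fin n} (hm : ∀ a, a ≤ m) {A : PowerSeries ℂ}
    (h : HasQuotientEigenvalue (tensorFamily (evalFamily y fun i j => -E j i) t m m) A) :
    ∃ A', HasQuotientEigenvalue (t m m) A' ∧ (A = A' ∨ A = evalSeries y (-1) * A') := by
  refine Exists.elim (h.of_filtration Fin.val_injective iSup_range_mk_single
    (s := fun a => if a = m then
      fun r => ∑ p ∈ antidiagonal r, PowerSeries.coeff p.1 (evalSeries y (-1)) • t m m p.2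
      else t m m) ?_) fun a ha => ?_
  · intro a r x
    simp only [TensorProduct.mk_apply]
    cases r with
    | zero =>
      rw [tensorFamily_evalFamily_zero]
      refine mem_of_eq_zero ?_
      split_ifs <;> simp [evalSeries]
    | succ r =>
      rw [tensorFamily_evalFamily_succ]
      simp only [LinearMap.neg_apply, E_single]
      rcases eq_or_ne a m with rfl | h₁
      · simp only [if_true]
        rw [evalSeries_conv_succ, Fintype.sum_eq_add_sum_subtype_ne _ a]
        have h₁ : (Pi.single a 1 : Fin n → ℂ) ⊗ₜ[ℂ]
            (t a a (r + 1) + (-1 : ℂ) • ∑ p ∈ antidiagonal r, y ^ p.1 • t a a p.2) x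
            = (Pi.single a 1 : Fin n → ℂ) ⊗ₜ[ℂ] t a a (r + 1) x
              + (-(Pi.single a 1 : Fin n → ℂ)) ⊗ₜ[ℂ]
                ∑ p ∈ antidiagonal r, y ^ p.1 • t a a p.2 x := by
          simp [LinearMap.sum_apply, TensorProduct.tmul_add, TensorProduct.neg_tmul,
            TensorProduct.tmul_neg]
        rw [h₁, ← add_assoc, add_sub_cancel_left]
        refine Submodule.sum_mem _ fun b _ => ?_
        rw [TensorProduct.neg_tmul]
        exact neg_mem (mem_rangeBelow (e := fun a => TensorProduct.mk ℂ (Fin n → ℂ) N (Pi.single a 1))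
          (Fin.lt_def.1 (lt_of_le_of_ne (hm b.1) b.2)) _)
      · simp [h₁, h₁.symm]
  · split_ifs at ha with h
    · obtain ⟨A', h₁, h₂⟩ := ha.of_mul (by simp [evalSeries])
      exact ⟨A', h₁, Or.inr h₂⟩
    · exact ⟨A, ha, Or.inl rfl⟩

end

end Yangian

/-! ### Both directions of the theorem. -/

namespace Yangian

open YangianRep

variable {n : ℕ}

/-- A preimage of `v` in the submodule is an eigenvector modulo `K`, viewed as a subspace of the
whole module. -/
theorem HasQuotientEigenvalue.of_isSubquotient {V : Type*} [AddCommGroup V] [Module ℂ V]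
    [Module (Yangian n) V] [IsScalarTower ℂ (Yangian n) V] {M : YangianRep n}
    (h : IsSubquotient (Yangian n) V M.V) {v : V} (hv : v ≠ 0) {m : Fin n} {A : PowerSeries ℂ}
    (hA : ∀ r, (T m m r : Yangian n) • v = PowerSeries.coeff r A • v) :
    HasQuotientEigenvalue (M.family m m) A := by
  obtain ⟨N, K, ⟨e⟩⟩ := h
  obtain ⟨x, hx⟩ := K.mkQ_surjective (e v)
  have hmem : ∀ y : N, (y : M.V) ∈ (K.map N.subtype).restrictScalars ℂ ↔ y ∈ K := by
    intro y
    rw [Submodule.restrictScalars_mem, Submodule.mem_map]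
    exact ⟨fun ⟨z, hz, h⟩ => Subtype.ext h ▸ hz, fun hy => ⟨y, hy, rfl⟩⟩
  refine ⟨(K.map N.subtype).restrictScalars ℂ, fun r y hy => ?_, x, ?_, fun r => ?_⟩
  · exact Submodule.smul_mem (K.map N.subtype) (T m m r) hy
  · rw [hmem, ← Submodule.Quotient.mk_eq_zero]
    intro h0
    exact hv (e.map_eq_zero_iff.1 (hx.symm.trans h0))
  · have h₁ : (T m m r - algebraMap ℂ (Yangian n) (PowerSeries.coeff r A)) • v = 0 := by
      rw [sub_smul, hA, algebraMap_smul, sub_self]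
    have h₂ : (T m m r - algebraMap ℂ (Yangian n) (PowerSeries.coeff r A)) • x ∈ K := by
      rw [← Submodule.Quotient.mk_eq_zero, Submodule.Quotient.mk_smul]
      refine (congrArg _ hx).trans ?_
      rw [← map_smul, h₁, map_zero]
    have h₃ := (hmem _).2 h₂
    rw [Submodule.coe_smul, sub_smul, algebraMap_smul] at h₃
    exact h₃

/-- The eigenvalues of `T_{nn}(u)` on subquotients of tensor products of vector and covector modules
are shift ratios of rational functions, and of polynomials if there are no covector modules. -/
theorem exists_div_of_hasQuotientEigenvalue {m : Fin n} (hm : ∀ a, a ≤ m) (L : List (ℂ ⊕ ℂ)) :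
    ∀ A : PowerSeries ℂ, HasQuotientEigenvalue
      ((tensorList (L.map (Sum.elim (vector n) (covector n)))).family m m) A →
    ∃ p q : Polynomial ℂ, p ≠ 0 ∧ q ≠ 0 ∧ ((∀ z, Sum.inr z ∉ L) → q = 1) ∧
      (A : LaurentSeries ℂ) = shiftRatio p / shiftRatio q := by
  induction L with
  | nil =>
    intro A h
    refine ⟨1, 1, one_ne_zero, one_ne_zero, fun _ => rfl, ?_⟩
    have h' : HasQuotientEigenvalue ((triv n).family m m) A := h
    rw [family_triv] at h'
    have : A = 1 := HasQuotientEigenvalue.eq_of_scalar (W := ℂ) (fun r x => by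
      cases r <;> simp [trivFamily, PowerSeries.coeff_one]) h'
    simp [this, shiftRatio_one]
  | cons z L ih =>
    intro A h
    rcases z with z | z
    · have h' : HasQuotientEigenvalue ((tensor (vector n z)
        (tensorList (L.map (Sum.elim (vector n) (covector n))))).family m m) A := h
      rw [family_tensor_vector] at h'
      obtain ⟨A', hA', hA⟩ := h'.of_vector hm
      obtain ⟨p, q, hp, hq, hq', h₁⟩ := ih A' hA'
      have hq'' : (∀ z', Sum.inr z' ∉ Sum.inl z :: L) → q = 1 := fun h₂ =>
        hq' fun z' hz' => h₂ z' (List.mem_cons_of_mem _ hz')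
      rcases hA with rfl | rfl
      · exact ⟨p, q, hp, hq, hq'', h₁⟩
      · refine ⟨(Polynomial.X - Polynomial.C z) * p, q,
          mul_ne_zero (Polynomial.X_sub_C_ne_zero z) hp, hq, hq'', ?_⟩
        rw [PowerSeries.coe_mul, h₁, shiftRatio_mul, shiftRatio_X_sub_C, mul_div_assoc]
    · have h' : HasQuotientEigenvalue ((tensor (covector n z)
        (tensorList (L.map (Sum.elim (vector n) (covector n))))).family m m) A := h
      rw [family_tensor_covector] at h'
      obtain ⟨A', hA', hA⟩ := h'.of_covector hm
      obtain ⟨p, q, hp, hq, -, h₁⟩ := ih A' hA'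
      -- With a covector module present the condition on `q` is vacuous.
      have hno : ∀ q : Polynomial ℂ, (∀ z', Sum.inr z' ∉ Sum.inr z :: L) → q = 1 :=
        fun _ h₂ => absurd List.mem_cons_self (h₂ z)
      rcases hA with rfl | rfl
      · exact ⟨p, q, hp, hq, hno _, h₁⟩
      · refine ⟨p, (Polynomial.X - Polynomial.C z) * q, hp,
          mul_ne_zero (Polynomial.X_sub_C_ne_zero z) hq, hno _, ?_⟩
        rw [PowerSeries.coe_mul, h₁, shiftRatio_mul, ← shiftRatio_X_sub_C_inv, div_mul_eq_div_div,
          div_eq_mul_inv, div_eq_mul_inv, div_eq_mul_inv]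
        ring

theorem _root_.YangianRep.Realizes.isSubquotient {V : Type*} [AddCommGroup V] [Module ℂ V]
    [Module (Yangian n) V] [IsScalarTower ℂ (Yangian n) V] [IsSimpleModule (Yangian n) V]
    {L : List (YangianRep n)} {g : Fin n → LaurentSeries ℂ} (h : Realizes L g) {v : V}
    {a : Fin n → PowerSeries ℂ} (hv0 : v ≠ 0) (hv : IsHighest v a)
    (ha : ∀ i, (a i : LaurentSeries ℂ) = g i) : IsSubquotient (Yangian n) V (tensorList L).V := by
  obtain ⟨b, hb, x, hx, hxb⟩ := h
  obtain rfl : b = a := funext fun i =>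
    HahnSeries.ofPowerSeries_injective ((hb i).trans (ha i).symm)
  exact isSubquotient_of_isHighest hv0 hx hv ⟨hxb.upper, hxb.diag⟩

theorem exists_realizes_prod (P : Fin (n - 1) → Polynomial ℂ) (hP : ∀ i, P i ≠ 0)
    (s : Finset (Fin (n - 1))) : ∃ l : List ℂ, Realizes (l.map (vector n))
      fun i => ∏ j ∈ s, stepWeight n (j + 1) (shiftRatio (P j)) i := by
  induction s using Finset.induction_on with
  | empty => exact ⟨[], by simpa using realizes_nil⟩
  | insert j s hj ih =>
    obtain ⟨l, hl⟩ := ih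
    obtain ⟨l', hl'⟩ := exists_realizes_step (n := n) (k := j + 1) (by omega) (hP j)
    refine ⟨l' ++ l, ?_⟩
    rw [List.map_append]
    convert hl'.append hl using 2 with i
    rw [Finset.prod_insert hj]

theorem weight_eq_prod {hn : 0 < n} {P : Fin (n - 1) → Polynomial ℂ} {A : Fin n → LaurentSeries ℂ}
    (hA : ∀ i, A i ≠ 0) (h : ∀ i : Fin (n - 1),
      A ⟨i, by omega⟩ / A ⟨i + 1, by omega⟩ = shiftRatio (P i)) (d : ℕ) :
    ∀ i : Fin n, i.1 + d = n - 1 →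
      A i = A ⟨n - 1, by omega⟩ * ∏ j : Fin (n - 1), stepWeight n (j + 1) (shiftRatio (P j)) i := by
  induction d with
  | zero =>
    intro i hi
    have h₁ : i = ⟨n - 1, by omega⟩ := Fin.ext hi
    rw [Finset.prod_eq_one fun j _ => ?_, mul_one, ← h₁]
    rw [stepWeight, if_neg]
    have := j.2
    omega
  | succ d ih =>
    intro i hi
    have h₁ := h ⟨i, by omega⟩
    rw [div_eq_iff (hA _)] at h₁
    have h₂ := ih ⟨i + 1, by omega⟩ (by dsimp only; omega)
    change A i = _ at h₁
    dsimp only at h₁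
    rw [h₁, h₂, mul_left_comm]
    congr 1
    -- Passing from place `i + 1` to place `i` switches on exactly the factor with `j = i`.
    have h₃ : ∀ j : Fin (n - 1), stepWeight n (j + 1) (shiftRatio (P j)) i
        = (if j = ⟨i, by omega⟩ then shiftRatio (P j) else 1) *
          stepWeight n (j + 1) (shiftRatio (P j)) ⟨i + 1, by omega⟩ := by
      intro j
      by_cases hj : j = ⟨i, by omega⟩
      · subst hj
        simp [stepWeight]
      · have hj' : j.1 ≠ i := fun h => hj (Fin.ext h)
        rw [if_neg hj, one_mul, stepWeight, stepWeight]
        congr 1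
        simp only [eq_iff_iff]
        omega
    rw [Finset.prod_congr rfl fun j _ => h₃ j, Finset.prod_mul_distrib]
    simp

end Yangian

open Yangian YangianRep in
theorem mainTheorem1 (n : ℕ) (hn : 0 < n)
    (An : PowerSeries ℂ) (hAn : PowerSeries.constantCoeff An = 1)
    (P : Fin (n - 1) → Polynomial ℂ) (hP : ∀ i, (P i).Monic)
    (Ψ : Type*) [AddCommGroup Ψ] [Module ℂ Ψ] [Module (Yangian n) Ψ]
    [IsScalarTower ℂ (Yangian n) Ψ] [FiniteDimensional ℂ Ψ] [IsSimpleModule (Yangian n) Ψ]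
    (hΨ : Yangian.HasHighestData hn Ψ An P) :
    (Yangian.IsPolynomial n Ψ ↔
      ∃ Q : Polynomial ℂ, Q ≠ 0 ∧ (An : LaurentSeries ℂ)
        = Q.eval₂ HahnSeries.C (Yangian.u + 1) / Q.eval₂ HahnSeries.C Yangian.u) ∧
    (Yangian.IsRational n Ψ ↔
      ∃ Q : RatFunc ℂ, Q ≠ 0 ∧ (An : LaurentSeries ℂ)
        = Q.eval HahnSeries.C (Yangian.u + 1) / Q.eval HahnSeries.C Yangian.u) := by
  obtain ⟨v, A, hv0, hup, hdiag, hAn', hratio⟩ := hΨ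
  have hv : IsHighest v A := ⟨hup, hdiag⟩
  -- `T_{ii}^{(0)} = 1` forces a nonzero constant term, which allows the given ratios to be cleared.
  have hA0 : ∀ i, (A i : LaurentSeries ℂ) ≠ 0 := by
    intro i h0
    have h₁ := hdiag i 0
    rw [HahnSeries.ofPowerSeries_injective (h0.trans (map_zero _).symm), T_zero, if_pos rfl,
      one_smul, map_zero, zero_smul] at h₁
    exact hv0 h₁
  have hm : ∀ a : Fin n, a ≤ ⟨n - 1, by omega⟩ := fun a => Fin.le_def.2 (by dsimp only; omega)
  have hweight : ∀ i, (A i : LaurentSeries ℂ)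
      = An * ∏ j : Fin (n - 1), stepWeight n (j + 1) (shiftRatio (P j)) i := fun i => by
    rw [← hAn']
    exact weight_eq_prod (hn := hn) (A := fun i => (A i : LaurentSeries ℂ)) hA0 hratio (n - 1 - i) i
      (by omega)
  have hquot : ∀ {M : YangianRep n}, IsSubquotient (Yangian n) Ψ M.V →
      HasQuotientEigenvalue (M.family ⟨n - 1, by omega⟩ ⟨n - 1, by omega⟩) An := fun h =>
    HasQuotientEigenvalue.of_isSubquotient h hv0 fun r => hAn' ▸ hdiag _ r
  obtain ⟨l, hl⟩ := exists_realizes_prod P (fun i => (hP i).ne_zero) Finset.univ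
  have hinl : ∀ l : List ℂ, (l.map Sum.inl).map (Sum.elim (vector n) (covector n))
      = l.map (vector n) := fun l => by rw [List.map_map, Sum.elim_comp_inl]
  have hinr : ∀ l : List ℂ, (l.map Sum.inr).map (Sum.elim (vector n) (covector n))
      = l.map (covector n) := fun l => by rw [List.map_map, Sum.elim_comp_inr]
  have hall : ∀ {Q : Polynomial ℂ}, Q ≠ 0 →
      ∃ l : List ℂ, Realizes (l.map (vector n)) fun _ => shiftRatio Q := by
    intro Q hQ
    have h : stepWeight n n (shiftRatio Q) = fun _ => shiftRatio Q := by
      funext i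
      exact if_pos i.2
    exact h ▸ exists_realizes_step (n := n) le_rfl hQ
  refine ⟨⟨?_, ?_⟩, ⟨?_, ?_⟩⟩
  · rintro ⟨L, hL⟩
    rw [← hinl] at hL
    obtain ⟨p, q, hp, -, hq, h⟩ := exists_div_of_hasQuotientEigenvalue hm _ An (hquot hL)
    rw [hq (by simp), shiftRatio_one, div_one] at h
    exact ⟨p, hp, h⟩
  · rintro ⟨Q, hQ, h⟩
    obtain ⟨l', hl'⟩ := hall hQ
    refine ⟨l' ++ l, ?_⟩
    rw [List.map_append]
    exact (hl'.append hl).isSubquotient hv0 hv fun i => (hweight i).trans (congrArg (· * _) h)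
  · rintro ⟨L, hL⟩
    obtain ⟨p, q, hp, hq, -, h⟩ := exists_div_of_hasQuotientEigenvalue hm _ An (hquot hL)
    refine ⟨algebraMap _ _ p / algebraMap _ _ q, ?_, h.trans (ratFunc_eval_div hq).symm⟩
    exact div_ne_zero (by simpa using hp) (by simpa using hq)
  · rintro ⟨Q, hQ, h⟩
    rw [← RatFunc.num_div_denom Q, ratFunc_eval_div Q.denom_ne_zero] at h
    obtain ⟨l₁, h₁⟩ := hall (RatFunc.num_ne_zero hQ)
    obtain ⟨l₂, h₂⟩ := exists_realizes_inv (n := n) Q.denom_ne_zero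
    -- The first two blocks realize the numerator and the inverse denominator of `Q` in all places;
    -- the last realizes the `P_j`.
    refine ⟨(l₁.map Sum.inl ++ l₂.map Sum.inr) ++ l.map Sum.inl, ?_⟩
    rw [List.map_append, List.map_append, hinl, hinl, hinr]
    exact ((h₁.append h₂).append hl).isSubquotient hv0 hv fun i =>
      (hweight i).trans (by rw [h, div_eq_mul_inv])
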